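/- Let $k$ be a field of characteristic zero and let $L$ be a Lie algebra over $k$ (of any dimension) with a decreasing filtration by subspaces $L = L^1 \supseteq L^2 \supseteq L^3 \supseteq \cdots$ such that $[L^i, L^j] \subseteq L^{i+j}$ for all $i,j$. Let $U(L)$ be the universal enveloping algebra, with counit $\epsilon$ ($\epsilon(\ell)=0$ for $\ell\in L$) and coproduct $\Delta$, the algebra homomorphism with $\Delta(\ell) = 1\otimes \ell + \ell\otimes 1$ for $\ell\in L$. Filter $U(L)$ by the two-sided ideals $F^0=U(L)$, $F^1 = U(L)_+ := \ker\epsilon$ and $F^{p+1} = F^p\cdot U(L)_+ + (L^{p+1})$ for $p \ge 1$, where $(L^{p+1})$ is the two-sided ideal generated by $L^{p+1}$. Put $$\hat U(L) = \varprojlim_p U(L)/F^p, \qquad \hat L = \varprojlim_p L/L^p, \qquad \hat U(L)\,\hat\otimes\,\hat U(L) = \varprojlim_p U(L)/F^p\otimes_k U(L)/F^p,$$ where $\hat U(L)$ carries the inverse limit topology of the discrete quotients. Let $\hat U(L)_+$ be the kernel of the induced augmentation $\hat U(L)\to U(L)/F^1 \cong k$. The maps $\hat U(L)\to U(L)/F^{2p-1}\to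 U(L)/F^p\otimes U(L)/F^p$ induced by $\Delta$ define the completed coproduct $\Delta:\hat U(L)\to\hat U(L)\,\hat\otimes\,\hat U(L)$. Call $g\in\hat U(L)$ grouplike if $g\neq 0$ and $\Delta(g)=g\otimes g$ in $\hat U(L)\,\hat\otimes\,\hat U(L)$, and let $G(\hat U(L))$ be the set of grouplike elements. Then: 1. The series $\exp(x)=\sum_{n\ge 0} x^n/n!$ converges for every $x\in\hat U(L)_+$, the series $\log(1+s)=\sum_{n\ge 1}(-1)^{n-1}s^n/n$ converges for every $s\in\hat U(L)_+$, and $$\exp:\hat U(L)_+\to 1+\hat U(L)_+,\qquad \log: 1+\hat U(L)_+\to \hat U(L)_+$$ are mutually inverse bijections. 2. The natural map $\hat L\to\hat U(L)$ is injective with image in $\hat U(L)_+$, so that $\hat L$ is regarded as a subset of $\hat U(L)_+$; moreover $G(\hat U(L))\subseteq 1+\hat U(L)_+$; and $\exp$ and $\log$ restrict to mutually inverse bijections between $\hat L$ and $G(\hat U(L))$. -/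

import Mathlib

open scoped TensorProduct Nat

attribute [local instance 100] LieRing.ofAssociativeRing

universe u v

noncomputable section

/-- A decreasing filtration `L = L¹ ⊇ L² ⊇ L³ ⊇ ⋯` of a Lie algebra by subspaces such that
`[Lⁱ, Lʲ] ⊆ Lⁱ⁺ʲ`. The index `0` is only a convention: `one_eq_top` and `anti` force `L⁰ = L`,
and the bracket condition for `i = 0` or `j = 0` then follows from the other conditions. -/
structure LieFiltration (k : Type u) (L : Type v) [Field k] [LieRing L] [LieAlgebra k L] where
  part : ℕ → Submodule k L
  one_eq_top : part 1 = ⊤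
  anti : Antitone part
  lie_mem : ∀ {i j : ℕ} {x y : L}, x ∈ part i → y ∈ part j → ⁅x, y⁆ ∈ part (i + j)

section InverseLimit

/-- The inverse limit of a system of `k`-algebras indexed by `ℕ`, as the subalgebra of compatible
families in the product. -/
def inverseLimit {k : Type u} [CommRing k] {A : ℕ → Type v} [∀ p, Ring (A p)]
    [∀ p, Algebra k (A p)] (f : ∀ ⦃p q : ℕ⦄, p ≤ q → (A q →ₐ[k] A p)) :
    Subalgebra k (∀ p, A p) where
  carrier := {x | ∀ ⦃p q : ℕ⦄ (h : p ≤ q), f h (x q) = x p}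
  mul_mem' hx hy p q h := by simp [hx h, hy h]
  add_mem' hx hy p q h := by simp [hx h, hy h]
  algebraMap_mem' r p q h := by simp

end InverseLimit

namespace EnvelopingAlgebra

variable (k : Type u) (L : Type v) [Field k] [LieRing L] [LieAlgebra k L]

/-- The coproduct `Δ : U(L) → U(L) ⊗ U(L)`, the algebra map with `Δ(ℓ) = 1 ⊗ ℓ + ℓ ⊗ 1`. -/
def comul : UniversalEnvelopingAlgebra k L →ₐ[k]
    UniversalEnvelopingAlgebra k L ⊗[k] UniversalEnvelopingAlgebra k L :=
  UniversalEnvelopingAlgebra.lift k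
    { toFun := fun x => 1 ⊗ₜ[k] UniversalEnvelopingAlgebra.ι k x +
        UniversalEnvelopingAlgebra.ι k x ⊗ₜ[k] 1
      map_add' := fun x y => by
        simp only [map_add, TensorProduct.tmul_add, TensorProduct.add_tmul]; abel
      map_smul' := fun c x => by
        simp only [map_smul, TensorProduct.tmul_smul, TensorProduct.smul_tmul', smul_add,
          RingHom.id_apply]
      map_lie' := fun {x y} => by
        simp only [LieHom.map_lie, LieRing.of_associative_ring_bracket, mul_add, add_mul,
          Algebra.TensorProduct.tmul_mul_tmul, one_mul, mul_one, TensorProduct.tmul_sub,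
          TensorProduct.sub_tmul]
        abel }

/-- The counit `ε : U(L) → k`, the algebra map with `ε(ℓ) = 0`. -/
def counit : UniversalEnvelopingAlgebra k L →ₐ[k] k :=
  UniversalEnvelopingAlgebra.lift k (0 : L →ₗ⁅k⁆ k)

/-- The augmentation ideal `U(L)₊ = ker ε`. -/
def augIdeal : Ideal (UniversalEnvelopingAlgebra k L) :=
  RingHom.ker (counit k L)

instance : (augIdeal k L).IsTwoSided := by unfold augIdeal; infer_instance

variable {k L}

theorem comul_ι (x : L) : comul k L (UniversalEnvelopingAlgebra.ι k x) =
    1 ⊗ₜ[k] UniversalEnvelopingAlgebra.ι k x + UniversalEnvelopingAlgebra.ι k x ⊗ₜ[k] 1 :=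
  UniversalEnvelopingAlgebra.lift_ι_apply _ _ _

theorem ι_mem_augIdeal (x : L) : UniversalEnvelopingAlgebra.ι k x ∈ augIdeal k L := by
  have : counit k L (UniversalEnvelopingAlgebra.ι k x) = 0 :=
    UniversalEnvelopingAlgebra.lift_ι_apply _ _ _
  exact this

end EnvelopingAlgebra

namespace LieFiltration

open EnvelopingAlgebra

variable {k : Type u} {L : Type v} [Field k] [LieRing L] [LieAlgebra k L]
variable (N : LieFiltration k L)

/-- The two-sided ideal `(Lᵖ)` of `U(L)` generated by `Lᵖ`. -/
def genIdeal (p : ℕ) : Ideal (UniversalEnvelopingAlgebra k L) :=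
  (TwoSidedIdeal.span (UniversalEnvelopingAlgebra.ι k '' (N.part p : Set L))).asIdeal

instance (p : ℕ) : (N.genIdeal p).IsTwoSided := by unfold genIdeal; infer_instance

/-- The filtration of `U(L)` by two-sided ideals: `F¹ = U(L)₊` and
`Fᵖ⁺¹ = Fᵖ · U(L)₊ + (Lᵖ⁺¹)`; moreover `F⁰ = U(L)`. -/
def envFil : ℕ → Ideal (UniversalEnvelopingAlgebra k L)
  | 0 => ⊤
  | 1 => augIdeal k L
  | p + 2 => envFil (p + 1) * augIdeal k L ⊔ N.genIdeal (p + 2)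

instance envFil_isTwoSided : ∀ p : ℕ, (N.envFil p).IsTwoSided
  | 0 => by unfold envFil; infer_instance
  | 1 => by unfold envFil; infer_instance
  | p + 2 => by
    unfold envFil
    refine ⟨fun {a} b ha => ?_⟩
    obtain ⟨x, hx, y, hy, rfl⟩ := Submodule.mem_sup.1 ha
    rw [add_mul]
    exact Submodule.add_mem_sup (Ideal.mul_mem_right _ _ hx) (Ideal.mul_mem_right _ _ hy)

theorem genIdeal_le_augIdeal (p : ℕ) : N.genIdeal p ≤ augIdeal k L := by
  intro x hx
  have h : TwoSidedIdeal.span (UniversalEnvelopingAlgebra.ι k '' (N.part p : Set L)) ≤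
      (augIdeal k L).toTwoSided := by
    rw [TwoSidedIdeal.span_le]
    rintro _ ⟨l, -, rfl⟩
    simpa using ι_mem_augIdeal l
  simpa using h hx

theorem genIdeal_anti {p q : ℕ} (h : p ≤ q) : N.genIdeal q ≤ N.genIdeal p := by
  intro x hx
  exact TwoSidedIdeal.span_mono (Set.image_mono (N.anti h)) hx

theorem envFil_succ_le : ∀ p : ℕ, N.envFil (p + 1) ≤ N.envFil p
  | 0 => le_top
  | 1 => sup_le Ideal.mul_le_right (N.genIdeal_le_augIdeal 2)
  | p + 2 => sup_le_sup (Ideal.mul_mono_left (envFil_succ_le (p + 1)))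
      (N.genIdeal_anti (Nat.le_succ _))

theorem envFil_anti : Antitone N.envFil := antitone_nat_of_succ_le N.envFil_succ_le

theorem ι_mem_envFil {p : ℕ} {x : L} (hx : x ∈ N.part p) :
    UniversalEnvelopingAlgebra.ι k x ∈ N.envFil p := by
  match p with
  | 0 => trivial
  | 1 => exact ι_mem_augIdeal x
  | p + 2 =>
    exact Submodule.mem_sup_right (TwoSidedIdeal.subset_span (Set.mem_image_of_mem _ hx))

theorem mul_augIdeal_mem {p : ℕ} {x y : UniversalEnvelopingAlgebra k L} (hx : x ∈ N.envFil p)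
    (hy : y ∈ augIdeal k L) : x * y ∈ N.envFil (p + 1) := by
  match p with
  | 0 => exact Ideal.mul_mem_left _ _ hy
  | p + 1 => exact Submodule.mem_sup_left (Ideal.mul_mem_mul hx hy)

/-! ### The completed enveloping algebra -/

/-- The quotient algebra `U(L)/Fᵖ`. -/
abbrev EnvQuot (p : ℕ) : Type (max u v) := UniversalEnvelopingAlgebra k L ⧸ N.envFil p

/-- The projection `U(L)/F^q → U(L)/F^p` for `p ≤ q`. -/
def envTrans ⦃p q : ℕ⦄ (h : p ≤ q) : N.EnvQuot q →ₐ[k] N.EnvQuot p :=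
  Ideal.Quotient.factorₐ k (N.envFil_anti h)

/-- The completed enveloping algebra `Û(L) = lim U(L)/Fᵖ`. -/
abbrev CompletedEnv : Type (max u v) := inverseLimit N.envTrans

/-- The inverse limit topology on `Û(L)`, each `U(L)/Fᵖ` being discrete. -/
instance : TopologicalSpace N.CompletedEnv :=
  ⨅ p : ℕ, TopologicalSpace.induced (fun x : N.CompletedEnv => x.1 p) ⊥

/-- The augmentation `ε : Û(L) → U(L)/F¹ → k`. -/
def completedCounit : N.CompletedEnv →ₐ[k] k :=
  (Ideal.Quotient.liftₐ (N.envFil 1) (counit k L) fun _ ha => ha).comp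
    ((Pi.evalAlgHom k N.EnvQuot 1).comp (inverseLimit N.envTrans).val)

/-- The augmentation ideal `Û(L)₊`, as a set. -/
def completedAug : Set N.CompletedEnv := {x | N.completedCounit x = 0}

/-- The set `1 + Û(L)₊`. -/
def oneAddCompletedAug : Set N.CompletedEnv := (fun s => 1 + s) '' N.completedAug

/-! ### The completed coproduct -/

/-- The projection `U(L)/F^q ⊗ U(L)/F^q → U(L)/F^p ⊗ U(L)/F^p` for `p ≤ q`. -/
def tensorTrans ⦃p q : ℕ⦄ (h : p ≤ q) :
    N.EnvQuot q ⊗[k] N.EnvQuot q →ₐ[k] N.EnvQuot p ⊗[k] N.EnvQuot p :=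
  Algebra.TensorProduct.map (N.envTrans h) (N.envTrans h)

/-- The completed tensor product `Û(L) ⊗̂ Û(L) = lim U(L)/Fᵖ ⊗ U(L)/Fᵖ`. -/
abbrev CompletedTensor : Type (max u v) := inverseLimit N.tensorTrans

/-- The algebra map `Û(L) ⊗ Û(L) → Û(L) ⊗̂ Û(L)`, `x ⊗ y ↦ (x_p ⊗ y_p)_p`. -/
def toCompletedTensor : N.CompletedEnv ⊗[k] N.CompletedEnv →ₐ[k] N.CompletedTensor :=
  (AlgHom.pi fun p => Algebra.TensorProduct.map
    ((Pi.evalAlgHom k N.EnvQuot p).comp (inverseLimit N.envTrans).val)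
    ((Pi.evalAlgHom k N.EnvQuot p).comp (inverseLimit N.envTrans).val)).codRestrict _ <| by
      intro t p q h
      induction t with
      | zero => simp
      | add x y hx hy => rw [map_add, Pi.add_apply, Pi.add_apply, map_add, hx, hy]
      | tmul x y =>
        have hx := x.2 h
        have hy := y.2 h
        simp only [AlgHom.pi_apply, Algebra.TensorProduct.map_tmul, tensorTrans]
        exact congrArg₂ (· ⊗ₜ[k] ·) hx hy

/-- The map `U(L) → U(L)/Fᵖ ⊗ U(L)/F^q` induced by the coproduct. -/
def comulQuot (p q : ℕ) :
    UniversalEnvelopingAlgebra k L →ₐ[k] N.EnvQuot p ⊗[k] N.EnvQuot q :=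
  (Algebra.TensorProduct.map (Ideal.Quotient.mkₐ k (N.envFil p))
    (Ideal.Quotient.mkₐ k (N.envFil q))).comp (comul k L)

/-- The subspace `∑_{i+j=n} Fⁱ ⊗ Fʲ` of `U(L) ⊗ U(L)`. -/
def tensorFil (n : ℕ) :
    Submodule k (UniversalEnvelopingAlgebra k L ⊗[k] UniversalEnvelopingAlgebra k L) :=
  Submodule.span k {t | ∃ i j, i + j = n ∧ ∃ a ∈ N.envFil i, ∃ b ∈ N.envFil j, t = a ⊗ₜ[k] b}

theorem mul_mem_tensorFil {n : ℕ}
    {s t : UniversalEnvelopingAlgebra k L ⊗[k] UniversalEnvelopingAlgebra k L}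
    (hs : s ∈ N.tensorFil n) : s * t ∈ N.tensorFil n ∧ t * s ∈ N.tensorFil n := by
  induction hs using Submodule.span_induction with
  | zero => simp
  | add x y _ _ hx hy =>
    rw [add_mul, mul_add]
    exact ⟨add_mem hx.1 hy.1, add_mem hx.2 hy.2⟩
  | smul c x _ hx =>
    rw [smul_mul_assoc, mul_smul_comm]
    exact ⟨Submodule.smul_mem _ _ hx.1, Submodule.smul_mem _ _ hx.2⟩
  | mem x hx =>
    obtain ⟨i, j, hij, a, ha, b, hb, rfl⟩ := hx
    induction t with
    | zero => simp
    | add x y hx hy =>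
      rw [add_mul, mul_add]
      exact ⟨add_mem hx.1 hy.1, add_mem hx.2 hy.2⟩
    | tmul c d =>
      simp only [Algebra.TensorProduct.tmul_mul_tmul]
      exact ⟨Submodule.subset_span ⟨i, j, hij, _, Ideal.mul_mem_right _ _ ha, _,
          Ideal.mul_mem_right _ _ hb, rfl⟩,
        Submodule.subset_span ⟨i, j, hij, _, Ideal.mul_mem_left _ _ ha, _,
          Ideal.mul_mem_left _ _ hb, rfl⟩⟩

theorem mul_mem_tensorFil_succ {n : ℕ}
    {s t : UniversalEnvelopingAlgebra k L ⊗[k] UniversalEnvelopingAlgebra k L}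
    (hs : s ∈ N.tensorFil n) (ht : t ∈ N.tensorFil 1) : s * t ∈ N.tensorFil (n + 1) := by
  induction hs using Submodule.span_induction with
  | zero => simp
  | add x y _ _ hx hy => rw [add_mul]; exact add_mem hx hy
  | smul c x _ hx => rw [smul_mul_assoc]; exact Submodule.smul_mem _ _ hx
  | mem x hx =>
    obtain ⟨i, j, hij, a, ha, b, hb, rfl⟩ := hx
    induction ht using Submodule.span_induction with
    | zero => simp
    | add x y _ _ hx hy => rw [mul_add]; exact add_mem hx hy
    | smul c x _ hx => rw [mul_smul_comm]; exact Submodule.smul_mem _ _ hx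
    | mem x hx =>
      obtain ⟨i', j', hij', c, hc, d, hd, rfl⟩ := hx
      rw [Algebra.TensorProduct.tmul_mul_tmul]
      have h : (i' = 1 ∧ j' = 0) ∨ (i' = 0 ∧ j' = 1) := by omega
      obtain ⟨rfl, rfl⟩ | ⟨rfl, rfl⟩ := h
      · exact Submodule.subset_span ⟨i + 1, j, by omega, _, N.mul_augIdeal_mem ha hc, _,
          Ideal.mul_mem_right _ _ hb, rfl⟩
      · exact Submodule.subset_span ⟨i, j + 1, by omega, _, Ideal.mul_mem_right _ _ ha, _,
          N.mul_augIdeal_mem hb hd, rfl⟩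

theorem tmul_sub_mem_tensorFil_one
    (t : UniversalEnvelopingAlgebra k L ⊗[k] UniversalEnvelopingAlgebra k L)
    (ht : Algebra.TensorProduct.lift (counit k L) (counit k L) (fun _ _ => Commute.all _ _) t = 0) :
    t ∈ N.tensorFil 1 := by
  have key : ∀ t : UniversalEnvelopingAlgebra k L ⊗[k] UniversalEnvelopingAlgebra k L,
      t - algebraMap k _ (Algebra.TensorProduct.lift (counit k L) (counit k L)
        (fun _ _ => Commute.all _ _) t) ∈ N.tensorFil 1 := by
    intro t
    induction t with
    | zero => simp
    | add x y hx hy =>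
      rw [map_add, map_add, add_sub_add_comm]
      exact add_mem hx hy
    | tmul a b =>
      have haug : ∀ c : UniversalEnvelopingAlgebra k L,
          c - algebraMap k _ (counit k L c) ∈ N.envFil 1 := by
        intro c
        change counit k L _ = 0
        simp
      have e : a ⊗ₜ[k] b - algebraMap k _ (Algebra.TensorProduct.lift (counit k L) (counit k L)
          (fun _ _ => Commute.all _ _) (a ⊗ₜ[k] b)) =
          (a - algebraMap k _ (counit k L a)) ⊗ₜ[k] b +
          algebraMap k _ (counit k L a) ⊗ₜ[k] (b - algebraMap k _ (counit k L b)) := by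
        rw [Algebra.TensorProduct.lift_tmul, TensorProduct.sub_tmul, TensorProduct.tmul_sub,
          Algebra.TensorProduct.algebraMap_apply, Algebra.algebraMap_eq_smul_one (counit k L a),
          Algebra.algebraMap_eq_smul_one (counit k L b), Algebra.algebraMap_eq_smul_one,
          ← TensorProduct.smul_tmul', ← TensorProduct.smul_tmul', ← TensorProduct.smul_tmul',
          TensorProduct.tmul_smul, mul_smul]
        abel
      rw [e]
      exact add_mem (Submodule.subset_span ⟨1, 0, rfl, _, haug a, _, trivial, rfl⟩)
        (Submodule.subset_span ⟨0, 1, rfl, _, trivial, _, haug b, rfl⟩)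
  simpa [ht] using key t

theorem comul_mem_of_mem_augIdeal {x : UniversalEnvelopingAlgebra k L} (hx : x ∈ augIdeal k L) :
    comul k L x ∈ N.tensorFil 1 := by
  apply N.tmul_sub_mem_tensorFil_one
  have h : (Algebra.TensorProduct.lift (counit k L) (counit k L)
      (fun _ _ => Commute.all _ _)).comp (comul k L) = counit k L := by
    apply UniversalEnvelopingAlgebra.hom_ext
    refine LieHom.ext fun l => ?_
    have : counit k L (UniversalEnvelopingAlgebra.ι k l) = 0 := ι_mem_augIdeal l
    change Algebra.TensorProduct.lift (counit k L) (counit k L) (fun _ _ => Commute.all _ _)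
      (comul k L (UniversalEnvelopingAlgebra.ι k l)) =
        counit k L (UniversalEnvelopingAlgebra.ι k l)
    rw [comul_ι, map_add, Algebra.TensorProduct.lift_tmul, Algebra.TensorProduct.lift_tmul, this]
    simp
  exact (AlgHom.congr_fun h x).trans hx

theorem comul_mem_of_mem_genIdeal {p : ℕ} {x : UniversalEnvelopingAlgebra k L}
    (hx : x ∈ N.genIdeal p) : comul k L x ∈ N.tensorFil p := by
  let I : TwoSidedIdeal (UniversalEnvelopingAlgebra k L) :=
    TwoSidedIdeal.mk' {x | comul k L x ∈ N.tensorFil p} (by simp)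
      (fun {x y} hx hy => by
        simp only [Set.mem_ofPred_eq, map_add] at *; exact add_mem hx hy)
      (fun {x} hx => by
        simp only [Set.mem_ofPred_eq, map_neg] at *; exact neg_mem hx)
      (fun {x y} hy => by
        simp only [Set.mem_ofPred_eq, map_mul] at *; exact (N.mul_mem_tensorFil hy).2)
      (fun {x y} hx => by
        simp only [Set.mem_ofPred_eq, map_mul] at *; exact (N.mul_mem_tensorFil hx).1)
  have h : TwoSidedIdeal.span (UniversalEnvelopingAlgebra.ι k '' (N.part p : Set L)) ≤ I := by
    rw [TwoSidedIdeal.span_le]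
    rintro _ ⟨l, hl, rfl⟩
    simp only [I, SetLike.mem_coe, TwoSidedIdeal.mem_mk', Set.mem_ofPred_eq, comul_ι]
    exact add_mem
      (Submodule.subset_span ⟨0, p, by simp, _, trivial, _, N.ι_mem_envFil hl, rfl⟩)
      (Submodule.subset_span ⟨p, 0, by simp, _, N.ι_mem_envFil hl, _, trivial, rfl⟩)
  simpa [I] using h hx

/-- `Δ(Fⁿ) ⊆ ∑_{i+j=n} Fⁱ ⊗ Fʲ`. -/
theorem comul_mem_tensorFil : ∀ (n : ℕ) {x : UniversalEnvelopingAlgebra k L},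
    x ∈ N.envFil n → comul k L x ∈ N.tensorFil n
  | 0, x, _ => by
    generalize comul k L x = t
    induction t with
    | zero => simp
    | add x y hx hy => exact add_mem hx hy
    | tmul a b => exact Submodule.subset_span ⟨0, 0, rfl, a, trivial, b, trivial, rfl⟩
  | 1, x, hx => N.comul_mem_of_mem_augIdeal hx
  | n + 2, x, hx => by
    obtain ⟨y, hy, z, hz, rfl⟩ := Submodule.mem_sup.1 hx
    rw [map_add]
    refine add_mem ?_ (N.comul_mem_of_mem_genIdeal hz)
    clear hx
    induction hy using Submodule.mul_induction_on' with
    | mem_mul_mem a ha b hb =>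
      rw [map_mul]
      exact N.mul_mem_tensorFil_succ (comul_mem_tensorFil (n + 1) ha)
        (N.comul_mem_of_mem_augIdeal hb)
    | add x _ y _ hx hy =>
      rw [map_add]; exact add_mem hx hy

theorem comulQuot_eq_zero {p q n : ℕ} (h : p + q ≤ n + 1) {x : UniversalEnvelopingAlgebra k L}
    (hx : x ∈ N.envFil n) : N.comulQuot p q x = 0 := by
  have hx' := N.comul_mem_tensorFil n hx
  change Algebra.TensorProduct.map _ _ (comul k L x) = 0
  generalize comul k L x = t at hx'
  induction hx' using Submodule.span_induction with
  | zero => simp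
  | add x y _ _ hx hy => rw [map_add, hx, hy, add_zero]
  | smul c x _ hx => rw [map_smul, hx, smul_zero]
  | mem x hx =>
    obtain ⟨i, j, hij, a, ha, b, hb, rfl⟩ := hx
    rw [Algebra.TensorProduct.map_tmul]
    by_cases hi : p ≤ i
    · have : Ideal.Quotient.mkₐ k (N.envFil p) a = 0 :=
        Ideal.Quotient.eq_zero_iff_mem.2 (N.envFil_anti hi ha)
      rw [this, TensorProduct.zero_tmul]
    · have : Ideal.Quotient.mkₐ k (N.envFil q) b = 0 :=
        Ideal.Quotient.eq_zero_iff_mem.2 (N.envFil_anti (by omega) hb)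
      rw [this, TensorProduct.tmul_zero]

/-- The map `U(L)/F^{2p-1} → U(L)/Fᵖ ⊗ U(L)/Fᵖ` induced by the coproduct. -/
def comulLevel (p : ℕ) : N.EnvQuot (2 * p - 1) →ₐ[k] N.EnvQuot p ⊗[k] N.EnvQuot p :=
  Ideal.Quotient.liftₐ (N.envFil (2 * p - 1)) (N.comulQuot p p)
    fun _ hx => N.comulQuot_eq_zero (by omega) hx

/-- The completed coproduct `Δ : Û(L) → Û(L) ⊗̂ Û(L)`, given at level `p` by
`Û(L) → U(L)/F^{2p-1} → U(L)/Fᵖ ⊗ U(L)/Fᵖ`. -/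
def completedComul : N.CompletedEnv →ₐ[k] N.CompletedTensor :=
  (AlgHom.pi fun p => (N.comulLevel p).comp
    ((Pi.evalAlgHom k N.EnvQuot (2 * p - 1)).comp (inverseLimit N.envTrans).val)).codRestrict _ <| by
      intro x p q h
      have hx := x.2 (show 2 * p - 1 ≤ 2 * q - 1 by omega)
      change N.tensorTrans h (N.comulLevel q (x.1 (2 * q - 1))) =
        N.comulLevel p (x.1 (2 * p - 1))
      rw [← hx]
      obtain ⟨y, hy⟩ := Ideal.Quotient.mk_surjective (x.1 (2 * q - 1))
      rw [← hy]
      change Algebra.TensorProduct.map _ _ (Algebra.TensorProduct.map _ _ (comul k L y)) =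
        Algebra.TensorProduct.map _ _ (comul k L y)
      rw [← AlgHom.comp_apply, ← Algebra.TensorProduct.map_comp]
      rfl

/-- The grouplike elements `G(Û(L))`: the nonzero `g` with `Δ(g) = g ⊗ g`. -/
def grouplike : Set N.CompletedEnv :=
  {g | g ≠ 0 ∧ N.completedComul g = N.toCompletedTensor (g ⊗ₜ[k] g)}

/-! ### The completed Lie algebra -/

/-- `Lᵖ` as a Lie ideal of `L`. -/
def lieIdeal (p : ℕ) : LieIdeal k L :=
  { N.part p with
    lie_mem := fun {x m} hm => N.anti (Nat.le_add_left p 1)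
      (N.lie_mem (by rw [N.one_eq_top]; trivial) hm) }

theorem lieIdeal_anti {p q : ℕ} (h : p ≤ q) :
    (N.lieIdeal q).toSubmodule ≤ (N.lieIdeal p).toSubmodule := N.anti h

/-- The projection `L/L^q → L/L^p` for `p ≤ q`. -/
def lieTrans ⦃p q : ℕ⦄ (h : p ≤ q) : (L ⧸ N.lieIdeal q) →ₗ[k] (L ⧸ N.lieIdeal p) :=
  Submodule.factor (N.lieIdeal_anti h)

theorem lieTrans_lie {p q : ℕ} (h : p ≤ q) (x y : L ⧸ N.lieIdeal q) :
    N.lieTrans h ⁅x, y⁆ = ⁅N.lieTrans h x, N.lieTrans h y⁆ := by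
  induction x using Submodule.Quotient.induction_on with | _ x
  induction y using Submodule.Quotient.induction_on with | _ y
  rfl

/-- The underlying vector space of `L̂ = lim L/Lᵖ`. -/
def completedLieSubmodule : Submodule k (∀ p, L ⧸ N.lieIdeal p) where
  carrier := {x | ∀ ⦃p q : ℕ⦄ (h : p ≤ q), N.lieTrans h (x q) = x p}
  add_mem' hx hy p q h := by simp [hx h, hy h]
  zero_mem' p q h := by simp
  smul_mem' c x hx p q h := by simp [hx h]

/-- The completed Lie algebra `L̂ = lim L/Lᵖ`. -/
abbrev CompletedLie : Type v := N.completedLieSubmodule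

instance : Bracket N.CompletedLie N.CompletedLie where
  bracket x y := ⟨fun p => ⁅x.1 p, y.1 p⁆, fun p q h => by rw [lieTrans_lie, x.2 h, y.2 h]⟩

instance : LieRing N.CompletedLie where
  add_lie x y z := Subtype.ext <| funext fun p => add_lie (x.1 p) (y.1 p) (z.1 p)
  lie_add x y z := Subtype.ext <| funext fun p => lie_add (x.1 p) (y.1 p) (z.1 p)
  lie_self x := Subtype.ext <| funext fun p => lie_self (x.1 p)
  leibniz_lie x y z := Subtype.ext <| funext fun p => leibniz_lie (x.1 p) (y.1 p) (z.1 p)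

instance : LieAlgebra k N.CompletedLie where
  lie_smul c x y := Subtype.ext <| funext fun p => lie_smul c (x.1 p) (y.1 p)

/-- The map `L/Lᵖ → U(L)/Fᵖ` induced by `L → U(L)`. -/
def ιLevel (p : ℕ) : (L ⧸ N.lieIdeal p) →ₗ[k] N.EnvQuot p :=
  (N.lieIdeal p).toSubmodule.liftQ
    ((Ideal.Quotient.mkₐ k (N.envFil p)).toLinearMap.comp
      (UniversalEnvelopingAlgebra.ι k : L →ₗ⁅k⁆ UniversalEnvelopingAlgebra k L).toLinearMap)
    fun _ hx => Ideal.Quotient.eq_zero_iff_mem.2 (N.ι_mem_envFil hx)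

theorem ιLevel_lie (p : ℕ) (x y : L ⧸ N.lieIdeal p) :
    N.ιLevel p ⁅x, y⁆ = N.ιLevel p x * N.ιLevel p y - N.ιLevel p y * N.ιLevel p x := by
  induction x using Submodule.Quotient.induction_on with | _ x
  induction y using Submodule.Quotient.induction_on with | _ y
  change Ideal.Quotient.mkₐ k (N.envFil p) (UniversalEnvelopingAlgebra.ι k ⁅x, y⁆) =
    Ideal.Quotient.mkₐ k (N.envFil p) (UniversalEnvelopingAlgebra.ι k x) *
      Ideal.Quotient.mkₐ k (N.envFil p) (UniversalEnvelopingAlgebra.ι k y) -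
    Ideal.Quotient.mkₐ k (N.envFil p) (UniversalEnvelopingAlgebra.ι k y) *
      Ideal.Quotient.mkₐ k (N.envFil p) (UniversalEnvelopingAlgebra.ι k x)
  rw [LieHom.map_lie, LieRing.of_associative_ring_bracket, map_sub, map_mul, map_mul]

/-- The natural Lie algebra map `L̂ → Û(L)`, the inverse limit of the maps `L/Lᵖ → U(L)/Fᵖ`. -/
def completedι : N.CompletedLie →ₗ⁅k⁆ N.CompletedEnv where
  toFun x := ⟨fun p => N.ιLevel p (x.1 p), fun p q h => by
    have hx := x.2 h
    obtain ⟨y, hy⟩ := Submodule.Quotient.mk_surjective _ (x.1 q)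
    change N.envTrans h (N.ιLevel q (x.1 q)) = N.ιLevel p (x.1 p)
    rw [← hx, ← hy]
    rfl⟩
  map_add' x y := Subtype.ext <| funext fun p => map_add (N.ιLevel p) (x.1 p) (y.1 p)
  map_smul' c x := Subtype.ext <| funext fun p => map_smul (N.ιLevel p) c (x.1 p)
  map_lie' {x y} := Subtype.ext <| funext fun p => N.ιLevel_lie p (x.1 p) (y.1 p)

/-! ### Exponential and logarithm -/

/-- The `n`-th term `xⁿ / n!` of `exp(x)`. -/
def expTerm (x : N.CompletedEnv) (n : ℕ) : N.CompletedEnv := ((n ! : k)⁻¹) • x ^ n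

/-- The term `(-1)ⁿ sⁿ⁺¹ / (n+1)`, with `s = y - 1`, of `log(y) = s - s²/2 + s³/3 - ⋯`. -/
def logTerm (y : N.CompletedEnv) (n : ℕ) : N.CompletedEnv :=
  ((-1 : k) ^ n / ((n : k) + 1)) • (y - 1) ^ (n + 1)

/-- `exp(x) = 1 + x + x²/2! + x³/3! + ⋯`, the sum being taken in the topology of `Û(L)`. -/
def exp (x : N.CompletedEnv) : N.CompletedEnv := ∑' n : ℕ, N.expTerm x n

/-- `log(1 + s) = s - s²/2 + s³/3 - ⋯`, the sum being taken in the topology of `Û(L)`. -/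
def log (y : N.CompletedEnv) : N.CompletedEnv := ∑' n : ℕ, N.logTerm y n

end LieFiltration

end

/-! Modulo `F^p` every `x ∈ Û(L)₊` is nilpotent, so each coordinate of the two series is a finite
sum, and part 1 reduces to polynomial congruences saying that truncated `exp` and `log` are inverse
modulo a power of `X`. For part 2, apply `ε ⊗ id` to `Δ(g) = g ⊗ g`: this gives `ε(g) g = g`, hence
`ε(g) = 1`. Since `1 ⊗ x` and `x ⊗ 1` commute, `exp` turns primitive elements into grouplike ones,
and injectivity of `exp` on nilpotents gives the converse for `log`. What remains is that `L/L^p →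
U(L)/F^p` is injective and that the primitive elements of `Û(L)` are exactly `L̂`.

Both rest on the operator `m ∘ Δ` (`convSq`) instead of a Poincaré–Birkhoff–Witt basis. Filter
`U(L)` by words, recording the number of letters and their total weight. On words of length at most
`n`, `m ∘ Δ` acts as `2^n` up to shorter words, without loss of weight (`convSq_sub_mem_words`). On
a primitive element it acts as `2`. In characteristic zero `2^n ≠ 2` for `n ≥ 2`, so a primitive
element can be shortened step by step to length one, keeping its weight
(`mem_words_one_of_convSq_eq`), and the same works for elements primitive only up to high weight
(`exists_sub_ι_mem_allWords`).

This gives injectivity only up to the kernel of `L → U(L)`. That the kernel vanishes (`ι_injective`)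
is obtained by writing `L` as the quotient of `t L[t]` under `t = 1`: the algebra `t L[t]` has a
faithful representation built from `d/dt`, and the shortening argument, with the kernel of
evaluation as the part of positive weight, descends injectivity to `L`. Finally, the weight
filtration and `F^p` are cofinal (`mem_allWords_of_mem_envFil`, `mem_envFil_of_mem_allWords`), so
results about weights pass to the completion. -/

noncomputable section

/-! ### Words of bounded length and weight, and the action of `m ∘ Δ` on them. -/

/-- A decreasing filtration of a Lie algebra, indexed by weights starting with `0`, such that
brackets add weights. -/
structure WeightFiltration (k : Type u) (L : Type v) [Field k] [LieRing L] [LieAlgebra k L] where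
  part : ℕ → Submodule k L
  zero_eq_top : part 0 = ⊤
  anti : Antitone part
  lie_mem : ∀ {i j : ℕ} {x y : L}, x ∈ part i → y ∈ part j → ⁅x, y⁆ ∈ part (i + j)

namespace EnvelopingAlgebra

open UniversalEnvelopingAlgebra

variable (k : Type u) (L : Type v) [Field k] [LieRing L] [LieAlgebra k L]

/-- The operator `m ∘ Δ` on `U(L)`, the convolution square of the identity. -/
def convSq : UniversalEnvelopingAlgebra k L →ₗ[k] UniversalEnvelopingAlgebra k L :=
  (LinearMap.mul' k (UniversalEnvelopingAlgebra k L)).comp (comul k L).toLinearMap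

variable {k L}

theorem convSq_apply (a : UniversalEnvelopingAlgebra k L) :
    convSq k L a = LinearMap.mul' k _ (comul k L a) := rfl

theorem convSq_one : convSq k L 1 = 1 := by
  simp [convSq_apply, Algebra.TensorProduct.one_def]

theorem convSq_ι (x : L) : convSq k L (ι k x) = (2 : k) • ι k x := by
  rw [convSq_apply, comul_ι, two_smul]
  simp [-ι_apply]

theorem mul_ι_sub_ι_mul (x y : L) : ι k x * ι k y - ι k y * ι k x = ι k ⁅x, y⁆ := by
  rw [LieHom.map_lie, LieRing.of_associative_ring_bracket]

end EnvelopingAlgebra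

namespace WeightFiltration

open EnvelopingAlgebra UniversalEnvelopingAlgebra

variable {k : Type u} {L : Type v} [Field k] [LieRing L] [LieAlgebra k L]
variable (W : WeightFiltration k L)

/-- The span of the products of at most `n` elements of `L` of total weight at least `p`. -/
def words : ℕ → ℕ → Submodule k (UniversalEnvelopingAlgebra k L)
  | 0, 0 => Submodule.span k {1}
  | 0, _ + 1 => ⊥
  | n + 1, p => words n p ⊔
      Submodule.span k {w | ∃ i j, i + j = p ∧ ∃ a ∈ words n i, ∃ x ∈ W.part j, w = a * ι k x}

theorem one_mem_words : (1 : UniversalEnvelopingAlgebra k L) ∈ W.words 0 0 := by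
  simp [words]

theorem words_zero_le {p : ℕ} {M : Submodule k (UniversalEnvelopingAlgebra k L)}
    (h : p = 0 → 1 ∈ M) : W.words 0 p ≤ M := by
  match p with
  | 0 => simpa [words, Submodule.span_le] using h
  | p + 1 => simp [words]

theorem words_succ_le {n p : ℕ} {M : Submodule k (UniversalEnvelopingAlgebra k L)}
    (h₁ : W.words n p ≤ M)
    (h₂ : ∀ i j, i + j = p → ∀ a ∈ W.words n i, ∀ x ∈ W.part j, a * ι k x ∈ M) :
    W.words (n + 1) p ≤ M := by
  rw [words]
  refine sup_le h₁ (Submodule.span_le.2 ?_)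
  rintro _ ⟨i, j, hij, a, ha, x, hx, rfl⟩
  exact h₂ i j hij a ha x hx

theorem words_le_succ (n p : ℕ) : W.words n p ≤ W.words (n + 1) p := by
  rw [words]
  exact le_sup_left

theorem words_mono (p : ℕ) : Monotone fun n => W.words n p :=
  monotone_nat_of_le_succ fun n => W.words_le_succ n p

theorem mul_ι_mem_words {n i j p : ℕ} (h : i + j = p) {a : UniversalEnvelopingAlgebra k L}
    (ha : a ∈ W.words n i) {x : L} (hx : x ∈ W.part j) : a * ι k x ∈ W.words (n + 1) p := by
  rw [words]
  exact Submodule.mem_sup_right (Submodule.subset_span ⟨i, j, h, a, ha, x, hx, rfl⟩)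

theorem ι_mem_words {p : ℕ} {x : L} (hx : x ∈ W.part p) : ι k x ∈ W.words 1 p := by
  simpa using W.mul_ι_mem_words (zero_add p) W.one_mem_words hx

theorem words_succ_weight_le : ∀ n p : ℕ, W.words n (p + 1) ≤ W.words n p
  | 0, p => W.words_zero_le (by simp)
  | n + 1, p => by
    refine W.words_succ_le ((words_succ_weight_le n p).trans (W.words_le_succ n p)) ?_
    intro i j hij a ha x hx
    match i with
    | 0 =>
      obtain rfl : j = p + 1 := by omega
      exact W.mul_ι_mem_words (zero_add p) ha (W.anti (Nat.le_succ p) hx)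
    | i + 1 => exact W.mul_ι_mem_words (by omega) (words_succ_weight_le n i ha) hx

theorem words_anti (n : ℕ) : Antitone (W.words n) :=
  antitone_nat_of_succ_le fun p => W.words_succ_weight_le n p

theorem mul_mem_words {m n p q r : ℕ} (h : p + q = r) {a b : UniversalEnvelopingAlgebra k L}
    (ha : a ∈ W.words m p) (hb : b ∈ W.words n q) : a * b ∈ W.words (m + n) r := by
  suffices W.words n q ≤ (W.words (m + n) r).comap (LinearMap.mulLeft k a) from this hb
  clear hb
  subst h
  induction n generalizing q with
  | zero => exact W.words_zero_le fun hq => by subst hq; simpa using ha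
  | succ n ih =>
    refine W.words_succ_le (fun c hc => W.words_le_succ _ _ (ih hc)) ?_
    rintro i j rfl c hc x hx
    simp only [Submodule.mem_comap, LinearMap.mulLeft_apply, ← mul_assoc, ← add_assoc]
    exact W.mul_ι_mem_words rfl (ih hc) hx

/-- The commutator with `x` is a derivation: it replaces one letter `y` at a time by `[y, x]`, so no
letter is added and the weight grows by that of `x`. -/
theorem lie_mem_words {n p q r : ℕ} (h : p + q = r) {b : UniversalEnvelopingAlgebra k L}
    (hb : b ∈ W.words n p) {x : L} (hx : x ∈ W.part q) :
    b * ι k x - ι k x * b ∈ W.words n r := by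
  suffices W.words n p ≤ (W.words n r).comap
    (LinearMap.mulRight k (ι k x) - LinearMap.mulLeft k (ι k x)) from this hb
  clear hb
  induction n generalizing p r with
  | zero => exact W.words_zero_le fun hp => by simp
  | succ n ih =>
    refine W.words_succ_le (fun c hc => W.words_le_succ _ _ (ih h hc)) ?_
    rintro i j rfl c hc y hy
    have e : c * ι k y * ι k x - ι k x * (c * ι k y) =
        (c * ι k x - ι k x * c) * ι k y + c * ι k ⁅y, x⁆ := by
      rw [← mul_ι_sub_ι_mul]; noncomm_ring
    simp only [Submodule.mem_comap, LinearMap.sub_apply, LinearMap.mulLeft_apply,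
      LinearMap.mulRight_apply, e]
    exact add_mem (W.mul_ι_mem_words (i := i + q) (j := j) (by omega) (ih rfl hc) hy)
      (W.mul_ι_mem_words (by omega) hc (W.lie_mem hy hx))

/-- The tensor product filtration induced by `words` on `U(L) ⊗ U(L)`. -/
def tensorWords (n p : ℕ) :
    Submodule k (UniversalEnvelopingAlgebra k L ⊗[k] UniversalEnvelopingAlgebra k L) :=
  Submodule.span k {t | ∃ i j, i + j = n ∧ ∃ q r, q + r = p ∧
    ∃ a ∈ W.words i q, ∃ b ∈ W.words j r, t = a ⊗ₜ[k] b}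

theorem tmul_mem_tensorWords {i j q r n p : ℕ} (hn : i + j = n) (hp : q + r = p)
    {a b : UniversalEnvelopingAlgebra k L} (ha : a ∈ W.words i q) (hb : b ∈ W.words j r) :
    a ⊗ₜ[k] b ∈ W.tensorWords n p :=
  Submodule.subset_span ⟨i, j, hn, q, r, hp, a, ha, b, hb, rfl⟩

theorem tensorWords_le {n p : ℕ}
    {M : Submodule k (UniversalEnvelopingAlgebra k L ⊗[k] UniversalEnvelopingAlgebra k L)}
    (h : ∀ i j, i + j = n → ∀ q r, q + r = p → ∀ a ∈ W.words i q, ∀ b ∈ W.words j r,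
      a ⊗ₜ[k] b ∈ M) : W.tensorWords n p ≤ M := by
  refine Submodule.span_le.2 ?_
  rintro _ ⟨i, j, hn, q, r, hp, a, ha, b, hb, rfl⟩
  exact h i j hn q r hp a ha b hb

/-- Letters are primitive, so `Δ` distributes the letters of a word over the two factors; lengths
and weights split accordingly. -/
theorem comul_mem_tensorWords {n p : ℕ} {a : UniversalEnvelopingAlgebra k L}
    (ha : a ∈ W.words n p) : comul k L a ∈ W.tensorWords n p := by
  suffices W.words n p ≤ (W.tensorWords n p).comap (comul k L).toLinearMap from this ha
  clear ha
  induction n generalizing p with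
  | zero =>
    refine W.words_zero_le fun hp => ?_
    subst hp
    simpa [Algebra.TensorProduct.one_def] using
      W.tmul_mem_tensorWords (zero_add 0) (zero_add 0) W.one_mem_words W.one_mem_words
  | succ n ih =>
    refine W.words_succ_le (fun c hc => ?_) ?_
    · refine (W.tensorWords_le fun i j hn q r hp a ha b hb => ?_ :
        W.tensorWords n p ≤ W.tensorWords (n + 1) p) (ih hc)
      exact W.tmul_mem_tensorWords (i := i + 1) (by omega) hp (W.words_le_succ _ _ ha) hb
    · rintro s t rfl c hc x hx
      simp only [Submodule.mem_comap, AlgHom.toLinearMap_apply, map_mul, comul_ι]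
      refine (W.tensorWords_le fun i j hn q r hp a ha b hb => ?_ :
        W.tensorWords n s ≤ (W.tensorWords (n + 1) (s + t)).comap
          (LinearMap.mulRight k (1 ⊗ₜ[k] ι k x + ι k x ⊗ₜ[k] 1))) (ih hc)
      simp only [Submodule.mem_comap, LinearMap.mulRight_apply, mul_add,
        Algebra.TensorProduct.tmul_mul_tmul, mul_one]
      exact add_mem
        (W.tmul_mem_tensorWords (j := j + 1) (by omega) (by omega) ha
          (W.mul_ι_mem_words (p := r + t) rfl hb hx))
        (W.tmul_mem_tensorWords (i := i + 1) (by omega) (by omega)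
          (W.mul_ι_mem_words (p := q + t) rfl ha hx) hb)

theorem convSq_mem_words {n p : ℕ} {a : UniversalEnvelopingAlgebra k L}
    (ha : a ∈ W.words n p) : convSq k L a ∈ W.words n p := by
  refine (W.tensorWords_le fun i j hn q r hp b hb c hc => ?_ :
    W.tensorWords n p ≤ (W.words n p).comap (LinearMap.mul' k _)) (W.comul_mem_tensorWords ha)
  subst hn
  exact W.mul_mem_words hp hb hc

/-- Multiplying by `x ∈ L` in the middle of `m ∘ Δ` instead of at its end changes the result by
shorter words. -/
theorem convSq_mul_ι_sub_mem_words {n p q r : ℕ} (h : p + q = r)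
    {a : UniversalEnvelopingAlgebra k L} (ha : a ∈ W.words n p) {x : L} (hx : x ∈ W.part q) :
    convSq k L (a * ι k x) - (2 : k) • (convSq k L a * ι k x) ∈ W.words n r := by
  have key : W.tensorWords n p ≤ (W.words n r).comap
      ((LinearMap.mul' k _).comp (LinearMap.mulRight k (1 ⊗ₜ[k] ι k x + ι k x ⊗ₜ[k] 1)) -
        (2 : k) • (LinearMap.mulRight k (ι k x)).comp (LinearMap.mul' k _)) := by
    clear ha
    refine W.tensorWords_le fun i j hn s t hp a ha b hb => ?_
    -- The only defect is moving `x` past the second factor `b`, a commutator that does not lengthen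
    -- the word.
    have e : a * (b * ι k x) + a * ι k x * b - (2 : k) • (a * b * ι k x) =
        -(a * (b * ι k x - ι k x * b)) := by
      rw [two_smul]; noncomm_ring
    simp only [Submodule.mem_comap, LinearMap.sub_apply, LinearMap.comp_apply,
      LinearMap.mulRight_apply, LinearMap.smul_apply, mul_add, map_add,
      Algebra.TensorProduct.tmul_mul_tmul, mul_one, LinearMap.mul'_apply, e]
    subst hn
    exact neg_mem (W.mul_mem_words (q := t + q) (by omega) ha (W.lie_mem_words rfl hb hx))
  rw [convSq_apply, convSq_apply, map_mul, comul_ι]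
  exact key (W.comul_mem_tensorWords ha)

theorem convSq_eq_of_mem_words_zero {p : ℕ} {a : UniversalEnvelopingAlgebra k L}
    (ha : a ∈ W.words 0 p) : convSq k L a = a :=
  (W.words_zero_le fun _ => convSq_one :
    W.words 0 p ≤ LinearMap.eqLocus (convSq k L) LinearMap.id) ha

/-- Each further letter contributes a factor `2`, since it can go to either tensor factor; the
reordering errors are shorter words of the same weight. -/
theorem convSq_sub_mem_words {n p : ℕ} {a : UniversalEnvelopingAlgebra k L}
    (ha : a ∈ W.words (n + 1) p) :
    convSq k L a - (2 : k) ^ (n + 1) • a ∈ W.words n p := by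
  suffices W.words (n + 1) p ≤
    (W.words n p).comap (convSq k L - (2 : k) ^ (n + 1) • LinearMap.id) from this ha
  clear ha
  induction n generalizing p with
  | zero =>
    refine W.words_succ_le
      (fun c hc => sub_mem (W.convSq_mem_words hc) (Submodule.smul_mem _ _ hc)) ?_
    intro i j hij c hc x hx
    simpa [W.convSq_eq_of_mem_words_zero hc] using W.convSq_mul_ι_sub_mem_words hij hc hx
  | succ n ih =>
    refine W.words_succ_le
      (fun c hc => sub_mem (W.convSq_mem_words hc) (Submodule.smul_mem _ _ hc)) ?_
    intro i j hij c hc x hx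
    have h := add_mem (W.convSq_mul_ι_sub_mem_words hij hc hx)
      (Submodule.smul_mem _ (2 : k) (W.mul_ι_mem_words hij (ih hc) hx))
    have e : convSq k L (c * ι k x) - (2 : k) • (convSq k L c * ι k x) +
        (2 : k) • ((convSq k L c - (2 : k) ^ (n + 1) • c) * ι k x) =
        convSq k L (c * ι k x) - (2 : k) ^ (n + 2) • (c * ι k x) := by
      rw [sub_mul, smul_sub, smul_mul_assoc, smul_smul, ← pow_succ']
      abel
    rw [Submodule.mem_comap]
    exact (congrArg (· ∈ W.words (n + 1) p) e).mp h

/-- At length `n + 2` both `2 • a` and `2 ^ (n + 2) • a` agree with `convSq k L a` up to shorter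
words. Their difference is a nonzero multiple of `a`, so `a` itself is shorter, with unchanged
weight. -/
theorem mem_words_one_of_convSq_eq [CharZero k] {n p : ℕ} {a : UniversalEnvelopingAlgebra k L}
    (ha : a ∈ W.words (n + 1) p) (h : convSq k L a = (2 : k) • a) : a ∈ W.words 1 p := by
  induction n with
  | zero => exact ha
  | succ n ih =>
    refine ih ?_
    have h₁ := W.convSq_sub_mem_words ha
    rw [h, ← sub_smul] at h₁
    refine (Submodule.smul_mem_iff _ ?_).1 h₁
    rw [pow_succ', ← mul_one_sub]
    have : ((2 ^ (n + 1) : ℕ) : k) ≠ 1 := by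
      exact_mod_cast (Nat.one_lt_two_pow (by omega)).ne'
    push_cast at this
    exact mul_ne_zero two_ne_zero (sub_ne_zero.2 this.symm)

/-- Words of positive weight and length one come from `L`. -/
theorem words_one_le {p : ℕ} :
    W.words 1 (p + 1) ≤ (W.part (p + 1)).map (ι k : L →ₗ⁅k⁆ _).toLinearMap := by
  refine W.words_succ_le (by simp [words]) ?_
  intro i j hij a ha x hx
  match i with
  | 0 =>
    obtain ⟨c, rfl⟩ := Submodule.mem_span_singleton.1 (show a ∈ Submodule.span k {1} from ha)
    obtain rfl : j = p + 1 := by omega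
    exact ⟨c • x, Submodule.smul_mem _ _ hx, by simp⟩
  | i + 1 =>
    obtain rfl : a = 0 := ha
    simp

/-- The union over all lengths of the words of weight at least `p`. -/
def allWords (p : ℕ) : Submodule k (UniversalEnvelopingAlgebra k L) := ⨆ n, W.words n p

theorem mem_allWords {p : ℕ} {a : UniversalEnvelopingAlgebra k L} :
    a ∈ W.allWords p ↔ ∃ n, a ∈ W.words n p :=
  Submodule.mem_iSup_of_directed _ (W.words_mono p).directed_le

theorem mul_mem_allWords {p q r : ℕ} (h : p + q = r) {a b : UniversalEnvelopingAlgebra k L}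
    (ha : a ∈ W.allWords p) (hb : b ∈ W.allWords q) : a * b ∈ W.allWords r := by
  rw [mem_allWords] at *
  obtain ⟨m, hm⟩ := ha
  obtain ⟨n, hn⟩ := hb
  exact ⟨m + n, W.mul_mem_words h hm hn⟩

theorem ι_mem_allWords {p : ℕ} {x : L} (hx : x ∈ W.part p) : ι k x ∈ W.allWords p :=
  W.mem_allWords.2 ⟨1, W.ι_mem_words hx⟩

theorem convSq_mem_allWords {p : ℕ} {a : UniversalEnvelopingAlgebra k L}
    (ha : a ∈ W.allWords p) : convSq k L a ∈ W.allWords p := by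
  rw [mem_allWords] at *
  exact ha.imp fun n hn => W.convSq_mem_words hn

/-- Words form a subalgebra containing `L`; by the universal property the identity of `U(L)` factors
through it. -/
theorem mem_allWords_zero (a : UniversalEnvelopingAlgebra k L) : a ∈ W.allWords 0 := by
  let S : Subalgebra k (UniversalEnvelopingAlgebra k L) :=
    (W.allWords 0).toSubalgebra (W.mem_allWords.2 ⟨0, W.one_mem_words⟩)
      fun _ _ ha hb => W.mul_mem_allWords (zero_add 0) ha hb
  let f : L →ₗ⁅k⁆ S :=
    { toFun := fun x => ⟨ι k x, W.ι_mem_allWords (by rw [W.zero_eq_top]; trivial)⟩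
      map_add' := fun x y => Subtype.ext (map_add _ x y)
      map_smul' := fun c x => Subtype.ext (map_smul _ c x)
      map_lie' := fun {x y} => Subtype.ext (LieHom.map_lie _ x y) }
  have h : S.val.comp (UniversalEnvelopingAlgebra.lift k f) = AlgHom.id k _ := by
    apply UniversalEnvelopingAlgebra.hom_ext
    refine LieHom.ext fun x => ?_
    change ((UniversalEnvelopingAlgebra.lift k f (ι k x) : S) : UniversalEnvelopingAlgebra k L) =
      ι k x
    rw [lift_ι_apply]
    rfl
  have := AlgHom.congr_fun h a
  rw [AlgHom.id_apply] at this
  rw [← this]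
  exact (UniversalEnvelopingAlgebra.lift k f a).2

theorem span_ι_part_le_allWords {p : ℕ} {a : UniversalEnvelopingAlgebra k L}
    (ha : a ∈ TwoSidedIdeal.span (ι k '' (W.part p : Set L))) : a ∈ W.allWords p := by
  let I : TwoSidedIdeal (UniversalEnvelopingAlgebra k L) :=
    TwoSidedIdeal.mk' (W.allWords p) (zero_mem _) (fun hx hy => add_mem hx hy)
      (fun hx => neg_mem hx)
      (fun {x _} hy => W.mul_mem_allWords (zero_add p) (W.mem_allWords_zero x) hy)
      (fun {_ y} hx => W.mul_mem_allWords (add_zero p) hx (W.mem_allWords_zero y))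
  have h : TwoSidedIdeal.span (ι k '' (W.part p : Set L)) ≤ I := by
    rw [TwoSidedIdeal.span_le]
    rintro _ ⟨l, hl, rfl⟩
    simpa [I] using W.ι_mem_allWords hl
  simpa [I] using h ha

/-- The substitute for a basis theorem: elements of `L` are eigenvectors of `convSq` for `2`, so
their weight in `U(L)` is already attained by a single letter. Injectivity of `ι` is not assumed,
hence the separate `y`. -/
theorem exists_mem_part_of_ι_mem_allWords [CharZero k] {p : ℕ} {x : L}
    (hx : ι k x ∈ W.allWords (p + 1)) : ∃ y ∈ W.part (p + 1), ι k y = ι k x := by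
  obtain ⟨n, hn⟩ := W.mem_allWords.1 hx
  exact W.words_one_le
    (W.mem_words_one_of_convSq_eq (W.words_mono _ (Nat.le_succ n) hn) (convSq_ι x))

end WeightFiltration

/-! ### Polynomial Lie algebras and a faithful representation of `t L[t]`. -/

/-- The Lie algebra `L[t]` of polynomials with coefficients in a Lie algebra `L`. -/
def PolynomialCurrent (k : Type u) (L : Type v) [Field k] [LieRing L] [LieAlgebra k L] :
    Type (max u v) :=
  Polynomial k ⊗[k] L

namespace PolynomialCurrent

open Polynomial

variable (k : Type u) (L : Type v) [Field k] [LieRing L] [LieAlgebra k L]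

instance : LieRing (PolynomialCurrent k L) := inferInstanceAs (LieRing (k[X] ⊗[k] L))

instance : LieAlgebra k (PolynomialCurrent k L) := inferInstanceAs (LieAlgebra k (k[X] ⊗[k] L))

variable {k L}

/-- The polynomial with coefficients in `L` given by a scalar polynomial times an element of `L`. -/
def pure (p : k[X]) (x : L) : PolynomialCurrent k L := p ⊗ₜ[k] x

theorem pure_lie_pure (p q : k[X]) (x y : L) : ⁅pure p x, pure q y⁆ = pure (p * q) ⁅x, y⁆ :=
  LieAlgebra.ExtendScalars.bracket_tmul k k[X] L L p q x y

theorem add_pure (p q : k[X]) (x : L) : pure (p + q) x = pure p x + pure q x :=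
  TensorProduct.add_tmul p q x

theorem induction_pure {motive : PolynomialCurrent k L → Prop} (zero : motive 0)
    (pure : ∀ p x, motive (pure p x)) (add : ∀ a b, motive a → motive b → motive (a + b))
    (a : PolynomialCurrent k L) : motive a :=
  TensorProduct.induction_on a zero pure add

/-- The map on `L[t]` induced by a linear map on scalar polynomials. -/
def mapScalar (f : k[X] →ₗ[k] k[X]) : PolynomialCurrent k L →ₗ[k] PolynomialCurrent k L :=
  f.rTensor L

theorem mapScalar_pure (f : k[X] →ₗ[k] k[X]) (p : k[X]) (x : L) :
    mapScalar f (pure p x) = pure (f p) x := rfl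

variable (k L) in
/-- The linear map underlying evaluation at `c`. -/
def evalLinear (c : k) : PolynomialCurrent k L →ₗ[k] L :=
  ((TensorProduct.lid k L).toLinearMap ∘ₗ (Polynomial.aeval c).toLinearMap.rTensor L :
    k[X] ⊗[k] L →ₗ[k] L)

theorem evalLinear_pure (c : k) (p : k[X]) (x : L) : evalLinear k L c (pure p x) = p.eval c • x :=
  rfl

variable (k L) in
/-- Evaluation at `c`. -/
def eval (c : k) : PolynomialCurrent k L →ₗ⁅k⁆ L :=
  { evalLinear k L c with
    map_lie' := fun {a b} => by
      change evalLinear k L c ⁅a, b⁆ = ⁅evalLinear k L c a, evalLinear k L c b⁆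
      induction a using induction_pure with
      | zero => simp
      | add a a' ha ha' => simp only [add_lie, map_add, ha, ha']
      | pure p x =>
        induction b using induction_pure with
        | zero => simp
        | add b b' hb hb' => simp only [lie_add, map_add, hb, hb']
        | pure q y => simp [pure_lie_pure, evalLinear_pure, smul_smul, mul_comm] }

theorem eval_pure (c : k) (p : k[X]) (x : L) : eval k L c (pure p x) = p.eval c • x :=
  evalLinear_pure c p x

variable (k L) in
/-- The formal derivative `d/dt` of `L[t]`. -/
def deriv : PolynomialCurrent k L →ₗ[k] PolynomialCurrent k L := mapScalar Polynomial.derivative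

/-- The Leibniz rule, arranged as the cocycle identity that makes `derivRep` a representation. -/
theorem deriv_lie (a b : PolynomialCurrent k L) :
    deriv k L ⁅a, b⁆ = ⁅a, deriv k L b⁆ - ⁅b, deriv k L a⁆ := by
  rw [← lie_skew b (deriv k L a), sub_neg_eq_add, add_comm]
  induction a using induction_pure with
  | zero => simp
  | add a a' ha ha' => simp only [add_lie, map_add, ha, ha']; abel
  | pure p x =>
    induction b using induction_pure with
    | zero => simp
    | add b b' hb hb' => simp only [lie_add, map_add, hb, hb']; abel
    | pure q y =>
      simp only [pure_lie_pure, deriv, mapScalar_pure, Polynomial.derivative_mul, add_pure]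

variable (k) in
/-- The antiderivative of a polynomial that vanishes at `0`. -/
def antideriv : k[X] →ₗ[k] k[X] :=
  Polynomial.lsum fun n => ((n + 1 : k)⁻¹) • Polynomial.monomial (n + 1)

theorem antideriv_derivative [CharZero k] (p : k[X]) :
    antideriv k p.derivative = p - C (p.eval 0) := by
  induction p using Polynomial.induction_on' with
  | add p q hp hq => simp only [map_add, hp, hq, eval_add]; abel
  | monomial n a =>
    rcases n with _ | n
    · simp
    · have : (n + 1 : k) ≠ 0 := Nat.cast_add_one_ne_zero n
      rw [derivative_monomial]
      simp [antideriv, Polynomial.lsum_apply, Polynomial.sum_monomial_index, smul_monomial]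
      field_simp

/-- In characteristic zero `a` is recovered as the antiderivative of `a'` plus the constant `a(0)`.
-/
theorem eq_zero_of_deriv_eq_zero [CharZero k] {a : PolynomialCurrent k L}
    (h₀ : eval k L 0 a = 0) (h : deriv k L a = 0) : a = 0 := by
  have key : mapScalar (antideriv k) (deriv k L a) + pure 1 (eval k L 0 a) = a := by
    clear h₀ h
    induction a using induction_pure with
    | zero =>
      simp only [map_zero, zero_add]
      exact TensorProduct.tmul_zero L 1
    | add a a' ha ha' =>
      conv_rhs => rw [← ha, ← ha']
      simp only [map_add, pure, TensorProduct.tmul_add]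
      abel
    | pure p x =>
      have e : pure 1 (p.eval 0 • x) = pure (C (p.eval 0)) x := by
        rw [pure, ← TensorProduct.smul_tmul, Polynomial.smul_eq_C_mul, mul_one, pure]
      rw [deriv, mapScalar_pure, mapScalar_pure, antideriv_derivative, eval_pure, e, ← add_pure,
        sub_add_cancel]
  rw [h, h₀, map_zero, zero_add] at key
  exact key.symm.trans (TensorProduct.tmul_zero L 1)

variable (k L) in
/-- The action of `L[t]` on `L[t] ⊕ k` with `a • (f, c) = ([a, f] + c a', 0)`, that is the adjoint
action on the semidirect product with the derivation `d/dt`. -/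
def derivRep : PolynomialCurrent k L →ₗ⁅k⁆ Module.End k ((PolynomialCurrent k L) × k) where
  toFun a := LinearMap.prod
    ((LieAlgebra.ad k (PolynomialCurrent k L) a).comp (LinearMap.fst k _ _) +
      (LinearMap.snd k (PolynomialCurrent k L) k).smulRight (deriv k L a)) 0
  map_add' a b := by
    refine LinearMap.ext fun f => Prod.ext ?_ (add_zero _).symm
    change ⁅a + b, f.1⁆ + f.2 • deriv k L (a + b) =
      (⁅a, f.1⁆ + f.2 • deriv k L a) + (⁅b, f.1⁆ + f.2 • deriv k L b)
    rw [map_add, add_lie, smul_add]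
    abel
  map_smul' c a := by
    refine LinearMap.ext fun f => Prod.ext ?_ (mul_zero _).symm
    change ⁅c • a, f.1⁆ + f.2 • deriv k L (c • a) = c • (⁅a, f.1⁆ + f.2 • deriv k L a)
    rw [map_smul, smul_lie, smul_add, smul_comm]
  map_lie' {a b} := by
    refine LinearMap.ext fun f => Prod.ext ?_ (sub_zero _).symm
    change ⁅⁅a, b⁆, f.1⁆ + f.2 • deriv k L ⁅a, b⁆ =
      (⁅a, ⁅b, f.1⁆ + f.2 • deriv k L b⁆ + (0 : k) • deriv k L a) -
        (⁅b, ⁅a, f.1⁆ + f.2 • deriv k L a⁆ + (0 : k) • deriv k L b)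
    rw [deriv_lie, lie_lie, lie_add, lie_add, lie_smul, lie_smul, zero_smul, zero_smul, smul_sub]
    abel

theorem deriv_eq_zero_of_derivRep_eq_zero {a : PolynomialCurrent k L} (h : derivRep k L a = 0) :
    deriv k L a = 0 := by
  have := congrArg Prod.fst (LinearMap.congr_fun h (0, 1))
  simpa [derivRep] using this

variable (k L) in
/-- The Lie subalgebra `t L[t]` of `L[t]`. -/
def vanishing : LieSubalgebra k (PolynomialCurrent k L) := LieIdeal.toLieSubalgebra k _ (eval k L 0).ker

theorem mem_vanishing {a : PolynomialCurrent k L} : a ∈ vanishing k L ↔ eval k L 0 a = 0 := LieHom.mem_ker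

/-- `derivRep` sends `(0, 1)` to `(a', 0)`, so it is faithful on polynomials without constant term;
any representation factors through the enveloping algebra. -/
theorem ι_vanishing_injective [CharZero k] :
    Function.Injective (UniversalEnvelopingAlgebra.ι k : vanishing k L →ₗ⁅k⁆ _) := by
  rw [← LieHom.coe_toLinearMap, ← LinearMap.ker_eq_bot, LinearMap.ker_eq_bot']
  intro a ha
  have h := UniversalEnvelopingAlgebra.lift_ι_apply k
    ((derivRep k L).comp (vanishing k L).incl) a
  rw [show UniversalEnvelopingAlgebra.ι k a = 0 from ha, map_zero] at h
  exact Subtype.ext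
    (eq_zero_of_deriv_eq_zero (mem_vanishing.1 a.2) (deriv_eq_zero_of_derivRep_eq_zero h.symm))

variable (k L) in
/-- Evaluation at `1`, as a map `t L[t] → L`. -/
def evalOne : vanishing k L →ₗ⁅k⁆ L := (eval k L 1).comp (vanishing k L).incl

/-- The element `t x` of `t L[t]`. -/
def linear (x : L) : vanishing k L := ⟨pure X x, by simp [mem_vanishing, eval_pure]⟩

theorem evalOne_linear (x : L) : evalOne k L (linear x) = x := by
  change eval k L 1 (pure X x) = x
  simp [eval_pure]

variable (k L) in
/-- The weight filtration of `t L[t]` whose part of positive weight is the kernel of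
evaluation at `1`. -/
def weight : WeightFiltration k (vanishing k L) where
  -- One ideal serves for all positive weights; only the distinction between weight `0` and weight
  -- `1` will be used.
  part p := if p = 0 then ⊤ else (evalOne k L).ker.toSubmodule
  zero_eq_top := if_pos rfl
  anti p q h := by
    by_cases hp : p = 0
    · simp [hp]
    · simp [hp, show q ≠ 0 by omega]
  lie_mem {i j x y} hx hy := by
    by_cases hi : i = 0 <;> by_cases hj : j = 0 <;> simp_all

theorem mem_part_weight_succ {p : ℕ} {a : vanishing k L} :
    a ∈ (weight k L).part (p + 1) ↔ evalOne k L a = 0 := by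
  simp [weight]

end PolynomialCurrent

/-! ### Injectivity of `L → U(L)`. -/

namespace EnvelopingAlgebra

open PolynomialCurrent

variable {k : Type u} {L : Type v} [Field k] [CharZero k] [LieRing L] [LieAlgebra k L]

/-- A Lie algebra over a field of characteristic zero embeds into its enveloping algebra. -/
theorem ι_injective : Function.Injective (UniversalEnvelopingAlgebra.ι k : L →ₗ⁅k⁆ _) := by
  rw [← LieHom.coe_toLinearMap, ← LinearMap.ker_eq_bot, LinearMap.ker_eq_bot']
  intro x hx
  -- `Q` is the enveloping algebra of `t L[t]` modulo the ideal generated by the kernel of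
  -- evaluation at `1`. The map `x ↦ t x` need not respect brackets, but it does after passing to
  -- `Q`, because `j` depends only on the value at `1`.
  let J : TwoSidedIdeal (UniversalEnvelopingAlgebra k (vanishing k L)) :=
    TwoSidedIdeal.span (UniversalEnvelopingAlgebra.ι k '' ((weight k L).part 1 : Set _))
  let Q := UniversalEnvelopingAlgebra k (vanishing k L) ⧸ J.asIdeal
  let π : UniversalEnvelopingAlgebra k (vanishing k L) →ₐ[k] Q := Ideal.Quotient.mkₐ k J.asIdeal
  let j : vanishing k L →ₗ⁅k⁆ Q :=
    (π : UniversalEnvelopingAlgebra k (vanishing k L) →ₗ⁅k⁆ Q).comp (UniversalEnvelopingAlgebra.ι k)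
  have hj : ∀ a b : vanishing k L, evalOne k L a = evalOne k L b → j a = j b := by
    intro a b h
    rw [← sub_eq_zero, ← map_sub]
    refine Ideal.Quotient.eq_zero_iff_mem.2 (TwoSidedIdeal.mem_asIdeal.2 ?_)
    refine TwoSidedIdeal.subset_span ⟨a - b, ?_, rfl⟩
    rw [SetLike.mem_coe, mem_part_weight_succ, map_sub, h, sub_self]
  let f : L →ₗ⁅k⁆ Q :=
    { toFun := fun y => j (linear y)
      map_add' := fun y z => by
        rw [← map_add]
        exact hj _ _ (by simp only [map_add, evalOne_linear])
      map_smul' := fun c y => by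
        rw [RingHom.id_apply, ← map_smul]
        exact hj _ _ (by simp only [map_smul, evalOne_linear])
      map_lie' := fun {y z} => by
        rw [← LieHom.map_lie]
        exact hj _ _ (by simp only [LieHom.map_lie, evalOne_linear]) }
  -- The Lie map `f` extends to `U(L)`, so `ι x = 0` kills `t x` in `Q`. Then `t x` has positive
  -- weight and, by shortening and injectivity for `t L[t]`, lies in the kernel of evaluation at
  -- `1`, whereas its value there is `x`.
  have hf : j (linear x) = 0 := by
    change f x = 0
    rw [← UniversalEnvelopingAlgebra.lift_ι_apply k f x]
    exact (congrArg _ hx).trans (map_zero _)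
  have hmem : UniversalEnvelopingAlgebra.ι k (linear x) ∈ (weight k L).allWords 1 :=
    (weight k L).span_ι_part_le_allWords
      (TwoSidedIdeal.mem_asIdeal.1 (Ideal.Quotient.eq_zero_iff_mem.1 hf))
  obtain ⟨y, hy, hyx⟩ := (weight k L).exists_mem_part_of_ι_mem_allWords hmem
  rw [mem_part_weight_succ, ι_vanishing_injective hyx] at hy
  exact (evalOne_linear x).symm.trans hy

end EnvelopingAlgebra

/-! ### Comparison of `F^p` with the weight filtration, and approximately primitive elements. -/

namespace LieFiltration

open EnvelopingAlgebra UniversalEnvelopingAlgebra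

variable {k : Type u} {L : Type v} [Field k] [LieRing L] [LieAlgebra k L]
variable (N : LieFiltration k L)

theorem part_zero : N.part 0 = ⊤ := top_le_iff.1 (N.one_eq_top ▸ N.anti zero_le_one)

/-- The filtration of `L`, regarded as a filtration by weights. -/
def toWeight : WeightFiltration k L where
  part := N.part
  zero_eq_top := N.part_zero
  anti := N.anti
  lie_mem := N.lie_mem

/-- The empty word has no positive weight, and every other word ends in a letter, which the counit
kills. -/
theorem words_succ_le_augIdeal (n p : ℕ) {a : UniversalEnvelopingAlgebra k L}
    (ha : a ∈ N.toWeight.words n (p + 1)) : a ∈ augIdeal k L := by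
  suffices N.toWeight.words n (p + 1) ≤ LinearMap.ker (counit k L).toLinearMap from this ha
  clear ha
  induction n generalizing p with
  | zero => exact N.toWeight.words_zero_le (by simp)
  | succ n ih =>
    refine N.toWeight.words_succ_le (ih p) fun i j _ a _ x _ => ?_
    exact (augIdeal k L).mul_mem_left a (ι_mem_augIdeal x)

theorem allWords_succ_le_augIdeal (p : ℕ) {a : UniversalEnvelopingAlgebra k L}
    (ha : a ∈ N.toWeight.allWords (p + 1)) : a ∈ augIdeal k L := by
  obtain ⟨n, hn⟩ := N.toWeight.mem_allWords.1 ha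
  exact N.words_succ_le_augIdeal n p hn

theorem eq_zero_of_smul_one_mem_augIdeal {c : k}
    (h : c • (1 : UniversalEnvelopingAlgebra k L) ∈ augIdeal k L) : c = 0 := by
  have h' : counit k L (c • 1) = 0 := h
  simpa using h'

/-- Since `L = L¹`, every nonempty word has weight at least `1`; only a scalar is left over, and the
counit detects it. -/
theorem mem_allWords_one_of_mem_augIdeal {a : UniversalEnvelopingAlgebra k L}
    (ha : a ∈ augIdeal k L) : a ∈ N.toWeight.allWords 1 := by
  obtain ⟨n, hn⟩ := N.toWeight.mem_allWords.1 (N.toWeight.mem_allWords_zero a)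
  have h : N.toWeight.words n 0 ≤ Submodule.span k {1} ⊔ N.toWeight.allWords 1 := by
    clear hn
    induction n with
    | zero => exact le_sup_left
    | succ n ih =>
      refine N.toWeight.words_succ_le ih fun i j _ b _ x _ => Submodule.mem_sup_right ?_
      exact N.toWeight.mul_mem_allWords (zero_add 1) (N.toWeight.mem_allWords_zero b)
        (N.toWeight.ι_mem_allWords (show x ∈ N.part 1 by rw [N.one_eq_top]; trivial))
  obtain ⟨y, hy, z, hz, rfl⟩ := Submodule.mem_sup.1 (h hn)
  obtain ⟨c, rfl⟩ := Submodule.mem_span_singleton.1 hy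
  have hc := (augIdeal k L).sub_mem ha (N.allWords_succ_le_augIdeal 0 hz)
  rw [add_sub_cancel_right] at hc
  simpa [eq_zero_of_smul_one_mem_augIdeal hc] using hz

/-- Weights add under products, so a factor from `U(L)₊` raises the weight by one. In the other
direction `F^p` counts such a factor only once, whatever its weight, which is why the converse below
needs weight `p * p`. -/
theorem mem_allWords_of_mem_envFil : ∀ (p : ℕ) {a : UniversalEnvelopingAlgebra k L},
    a ∈ N.envFil p → a ∈ N.toWeight.allWords p
  | 0, a, _ => N.toWeight.mem_allWords_zero a
  | 1, _, ha => N.mem_allWords_one_of_mem_augIdeal ha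
  | p + 2, _, ha => by
    obtain ⟨y, hy, z, hz, rfl⟩ := Submodule.mem_sup.1 ha
    refine add_mem ?_ (N.toWeight.span_ι_part_le_allWords (TwoSidedIdeal.mem_asIdeal.1 hz))
    clear ha
    induction hy using Submodule.mul_induction_on' with
    | mem_mul_mem a ha b hb =>
      exact N.toWeight.mul_mem_allWords (p := p + 1) (q := 1) rfl (mem_allWords_of_mem_envFil (p + 1) ha)
        (N.mem_allWords_one_of_mem_augIdeal hb)
    | add x _ y _ hx hy => exact add_mem hx hy

/-- A word of large weight either has many letters or a letter of large weight. -/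
theorem mem_envFil_of_mem_words {n p r : ℕ} (hr : r ≤ p) {a : UniversalEnvelopingAlgebra k L}
    (ha : a ∈ N.toWeight.words n (p * r)) : a ∈ N.envFil r := by
  suffices N.toWeight.words n (p * r) ≤ (N.envFil r).restrictScalars k from this ha
  clear ha a
  induction n generalizing r with
  | zero =>
    refine N.toWeight.words_zero_le fun h => ?_
    obtain rfl : r = 0 := by rcases Nat.mul_eq_zero.1 h with h | h <;> omega
    trivial
  | succ n ih =>
    refine N.toWeight.words_succ_le (ih hr) fun i j hij a ha x hx => ?_
    match r with
    | 0 => trivial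
    | r + 1 =>
      -- A last letter of weight at least `p` already lies in `F^p`. A lighter one leaves weight at
      -- least `p * r` to the rest and contributes one factor from `U(L)₊`.
      by_cases hj : p ≤ j
      · exact Ideal.mul_mem_left _ _ (N.envFil_anti (hr.trans hj) (N.ι_mem_envFil hx))
      · refine N.mul_augIdeal_mem (ih (by omega) ?_) (ι_mem_augIdeal x)
        rw [mul_add, mul_one] at hij
        exact N.toWeight.words_anti n (by omega) ha

theorem mem_envFil_of_mem_allWords {p : ℕ} {a : UniversalEnvelopingAlgebra k L}
    (ha : a ∈ N.toWeight.allWords (p * p)) : a ∈ N.envFil p := by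
  obtain ⟨n, hn⟩ := N.toWeight.mem_allWords.1 ha
  exact N.mem_envFil_of_mem_words le_rfl hn

variable [CharZero k]

/-- The filtration of `U(L)` induces the given filtration of `L`. -/
theorem mem_part_of_ι_mem_envFil {p : ℕ} {x : L} (hx : ι k x ∈ N.envFil p) : x ∈ N.part p := by
  rcases p with _ | p
  · rw [N.part_zero]
    trivial
  · obtain ⟨y, hy, hyx⟩ :=
      N.toWeight.exists_mem_part_of_ι_mem_allWords (N.mem_allWords_of_mem_envFil _ hx)
    exact ι_injective hyx ▸ hy

/-- The shortening argument with an error term: `a` is replaced by a shorter `a'` that differs from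
it only in weight at least `p`, so `a'` is again an eigenvector up to that weight. -/
theorem exists_sub_mem_allWords_of_mem_words {n p : ℕ} {a : UniversalEnvelopingAlgebra k L}
    (ha : a ∈ N.toWeight.words (n + 1) 0)
    (h : convSq k L a - (2 : k) • a ∈ N.toWeight.allWords p) :
    ∃ b ∈ N.toWeight.words 1 0, a - b ∈ N.toWeight.allWords p := by
  induction n generalizing a with
  | zero => exact ⟨a, ha, by simp⟩
  | succ n ih =>
    -- The difference of the expected eigenvalue `2` and the eigenvalue of top length; dividing by
    -- it makes `a'` congruent to `a`.
    set c : k := 2 - 2 ^ (n + 2) with hc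
    have hc₀ : c ≠ 0 := by
      have : ((2 ^ (n + 1) : ℕ) : k) ≠ 1 := by
        exact_mod_cast (Nat.one_lt_two_pow (by omega)).ne'
      push_cast at this
      rw [hc, pow_succ', ← mul_one_sub]
      exact mul_ne_zero two_ne_zero (sub_ne_zero.2 this.symm)
    set a' := c⁻¹ • (convSq k L a - (2 : k) ^ (n + 2) • a) with ha'
    have hmem : a' ∈ N.toWeight.words (n + 1) 0 :=
      Submodule.smul_mem _ _ (N.toWeight.convSq_sub_mem_words ha)
    have hdiff : a' - a ∈ N.toWeight.allWords p := by
      have e : a' - a = c⁻¹ • (convSq k L a - (2 : k) • a) := by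
        have e' : convSq k L a - (2 : k) ^ (n + 2) • a = (convSq k L a - (2 : k) • a) + c • a := by
          rw [hc, sub_smul]; abel
        rw [ha', e', smul_add, inv_smul_smul₀ hc₀, add_sub_cancel_right]
      exact e ▸ Submodule.smul_mem _ _ h
    have h' : convSq k L a' - (2 : k) • a' ∈ N.toWeight.allWords p := by
      have e : convSq k L a' - (2 : k) • a' = (convSq k L a - (2 : k) • a) +
          (convSq k L (a' - a) - (2 : k) • (a' - a)) := by
        rw [map_sub, smul_sub]; abel
      rw [e]
      exact add_mem h (sub_mem (N.toWeight.convSq_mem_allWords hdiff)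
        (Submodule.smul_mem _ _ hdiff))
    obtain ⟨b, hb, hab⟩ := ih hmem h'
    exact ⟨b, hb, by simpa using sub_mem hab hdiff⟩

/-- An element of `U(L)` that is primitive up to high filtration comes from `L` up to high
filtration. -/
theorem exists_sub_ι_mem_allWords {p : ℕ} {a : UniversalEnvelopingAlgebra k L}
    (h : convSq k L a - (2 : k) • a ∈ N.toWeight.allWords (p + 1)) :
    ∃ x : L, a - ι k x ∈ N.toWeight.allWords (p + 1) := by
  obtain ⟨n, hn⟩ := N.toWeight.mem_allWords.1 (N.toWeight.mem_allWords_zero a)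
  obtain ⟨b, hb, hab⟩ := N.exists_sub_mem_allWords_of_mem_words (N.toWeight.words_le_succ _ _ hn) h
  have hle : N.toWeight.words 1 0 ≤ Submodule.span k {1} ⊔
      LinearMap.range (ι k : L →ₗ⁅k⁆ UniversalEnvelopingAlgebra k L).toLinearMap := by
    refine N.toWeight.words_succ_le (n := 0) le_sup_left ?_
    intro i j hij c hc x _
    obtain rfl : i = 0 := by omega
    obtain ⟨d, rfl⟩ := Submodule.mem_span_singleton.1 (show c ∈ Submodule.span k {1} from hc)
    exact Submodule.mem_sup_right ⟨d • x, by simp⟩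
  obtain ⟨y, hy, z, ⟨x, hx⟩, hyz⟩ := Submodule.mem_sup.1 (hle hb)
  rw [← hyz, ← hx] at hab
  obtain ⟨c, rfl⟩ := Submodule.mem_span_singleton.1 hy
  change a - (c • 1 + ι k x) ∈ _ at hab
  -- `1` has eigenvalue `1` instead of `2`, so a scalar part would show up as an error of weight
  -- zero; positive weight forces `c = 0`.
  have hc : c • (1 : UniversalEnvelopingAlgebra k L) ∈ N.toWeight.allWords (p + 1) := by
    have e : c • (1 : UniversalEnvelopingAlgebra k L) =
        (convSq k L (a - (c • 1 + ι k x)) - (2 : k) • (a - (c • 1 + ι k x))) -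
          (convSq k L a - (2 : k) • a) := by
      simp only [map_sub, map_add, map_smul, convSq_one, convSq_ι, two_smul]
      abel
    rw [e]
    exact sub_mem (sub_mem (N.toWeight.convSq_mem_allWords hab) (Submodule.smul_mem _ _ hab)) h
  rw [eq_zero_of_smul_one_mem_augIdeal (N.allWords_succ_le_augIdeal p hc), zero_smul,
    zero_add] at hab
  exact ⟨x, hab⟩

end LieFiltration

/-! ### Truncated exponential and logarithm polynomials. -/

namespace TruncatedExp

open Polynomial

variable (k : Type u) [Field k]

/-- The exponential series truncated at degree `m`, as a polynomial. -/
def expPoly (m : ℕ) : k[X] := ∑ n ∈ Finset.range m, C ((n ! : k)⁻¹) * X ^ n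

/-- The series of `log(1 + X)` truncated after degree `m`, as a polynomial. -/
def logPoly (m : ℕ) : k[X] := ∑ n ∈ Finset.range m, C ((-1 : k) ^ n / ((n : k) + 1)) * X ^ (n + 1)

variable {k}

theorem expPoly_succ (m : ℕ) : expPoly k (m + 1) = expPoly k m + C ((m ! : k)⁻¹) * X ^ m :=
  Finset.sum_range_succ _ _

theorem eval_zero_expPoly (m : ℕ) : (expPoly k (m + 1)).eval 0 = 1 := by
  simp [expPoly, eval_finsetSum, Finset.sum_range_succ']

theorem eval_zero_logPoly (m : ℕ) : (logPoly k m).eval 0 = 0 := by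
  simp [logPoly, eval_finsetSum]

theorem X_dvd_expPoly_sub_one (m : ℕ) : X ∣ expPoly k (m + 1) - 1 := by
  rw [X_dvd_iff, coeff_zero_eq_eval_zero, eval_sub, eval_zero_expPoly, eval_one, sub_self]

theorem X_dvd_logPoly (m : ℕ) : X ∣ logPoly k m := by
  rw [X_dvd_iff, coeff_zero_eq_eval_zero, eval_zero_logPoly]

variable [CharZero k]

theorem derivative_expPoly (m : ℕ) : (expPoly k (m + 1)).derivative = expPoly k m := by
  simp only [expPoly, Finset.sum_range_succ', derivative_add, derivative_sum, derivative_C_mul,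
    derivative_X_pow, pow_zero, derivative_one, mul_zero, add_zero, Nat.add_sub_cancel]
  refine Finset.sum_congr rfl fun n _ => ?_
  have : (n + 1 : k) ≠ 0 := Nat.cast_add_one_ne_zero n
  rw [← mul_assoc, ← C_mul, Nat.factorial_succ]
  push_cast
  rw [mul_inv_rev, mul_assoc, inv_mul_cancel₀ this, mul_one]

theorem one_add_X_mul_derivative_logPoly (m : ℕ) :
    (1 + X) * (logPoly k m).derivative = 1 - (-X) ^ m := by
  have h : (logPoly k m).derivative = ∑ n ∈ Finset.range m, (-X : k[X]) ^ n := by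
    simp only [logPoly, derivative_sum, derivative_C_mul, derivative_X_pow, Nat.add_sub_cancel]
    refine Finset.sum_congr rfl fun n _ => ?_
    have : (n + 1 : k) ≠ 0 := Nat.cast_add_one_ne_zero n
    rw [← mul_assoc, ← C_mul]
    push_cast
    rw [div_mul_cancel₀ _ this, C_pow, C_neg, C_1, ← mul_pow, neg_one_mul]
  rw [h, ← mul_neg_geom_sum, sub_neg_eq_add]

theorem X_pow_succ_dvd_of_derivative {m : ℕ} {p : k[X]} (h₀ : p.eval 0 = 0)
    (h : X ^ m ∣ p.derivative) : X ^ (m + 1) ∣ p := by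
  rw [X_pow_dvd_iff] at h ⊢
  intro n hn
  rcases n with _ | n
  · rwa [coeff_zero_eq_eval_zero]
  · have := h n (by omega)
    rw [coeff_derivative] at this
    exact (mul_eq_zero.1 this).resolve_right (Nat.cast_add_one_ne_zero n)

/-- Both sides vanish at `0`, so it suffices to compare derivatives modulo `X ^ m`. There `e' ≡ e`,
and `(1 + X) log' ≡ 1` composed with `e - 1` makes the derivative of the composite `≡ 1`. -/
theorem X_pow_dvd_logPoly_comp (m : ℕ) :
    X ^ (m + 1) ∣ (logPoly k (m + 1)).comp (expPoly k (m + 1) - 1) - X := by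
  set e := expPoly k (m + 1) with he
  have hX : X ∣ e - 1 := X_dvd_expPoly_sub_one m
  apply X_pow_succ_dvd_of_derivative
  · rw [eval_sub, eval_comp, eval_sub, he, eval_zero_expPoly]
    simp [eval_zero_logPoly]
  have hd : e.derivative = e - C ((m ! : k)⁻¹) * X ^ m := by
    rw [he, derivative_expPoly, expPoly_succ, add_sub_cancel_right]
  have hl : e * (logPoly k (m + 1)).derivative.comp (e - 1) = 1 - (-(e - 1)) ^ (m + 1) := by
    have := congrArg (fun p => p.comp (e - 1)) (one_add_X_mul_derivative_logPoly (k := k) (m + 1))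
    simp only [mul_comp, add_comp, one_comp, X_comp, sub_comp, pow_comp, neg_comp] at this
    rwa [add_sub_cancel] at this
  -- `e` has constant term `1`, so divisibility by `X ^ m` may be tested after multiplying by `e`,
  -- where `hl` applies.
  have hcop : IsCoprime (X ^ m : k[X]) e := by
    apply IsCoprime.pow_left
    obtain ⟨q, hq⟩ := hX
    exact ⟨-q, 1, by rw [one_mul, eq_add_of_sub_eq hq]; ring⟩
  refine hcop.dvd_of_dvd_mul_left ?_
  have hdvd : (X : k[X]) ^ m ∣ (e - 1) ^ (m + 1) :=
    (pow_dvd_pow _ (Nat.le_succ m)).trans (pow_dvd_pow_of_dvd hX _)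
  have e1 : e * ((logPoly k (m + 1)).comp (e - 1) - X).derivative =
      -((e - 1) ^ (m + 1) * ((-1) ^ (m + 1) * (e - C ((m ! : k)⁻¹) * X ^ m))) +
        X ^ m * (-C ((m ! : k)⁻¹)) := by
    rw [neg_pow] at hl
    rw [derivative_sub, derivative_comp, derivative_sub, derivative_one, sub_zero, derivative_X, hd]
    linear_combination (e - C ((m ! : k)⁻¹) * X ^ m) * hl
  rw [e1]
  exact dvd_add ((hdvd.mul_right _).neg_right) (Dvd.intro _ rfl)

/-- Modulo `X ^ m`, both `b` and `1 + X` solve `(1 + X) y' = y`, with the same value at `0`. Their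
difference `d` then satisfies `(1 + X) d' ≡ d`, so each power of `X` dividing `d` divides `d'`,
which yields one more power in `d`. -/
theorem X_pow_dvd_expPoly_comp (m : ℕ) :
    X ^ (m + 1) ∣ (expPoly k (m + 1)).comp (logPoly k (m + 1)) - (1 + X) := by
  set l := logPoly k (m + 1) with hl
  set b := (expPoly k (m + 1)).comp l with hb
  have h₀ : (b - (1 + X)).eval 0 = 0 := by
    rw [hb, hl, eval_sub, eval_comp, eval_zero_logPoly, eval_zero_expPoly]
    simp
  have hd : b.derivative = (b - C ((m ! : k)⁻¹) * l ^ m) * l.derivative := by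
    rw [hb, derivative_comp, derivative_expPoly, expPoly_succ, add_comp, mul_comp, C_comp, X_pow_comp,
      add_sub_cancel_right, mul_comm]
  have hXl : X ^ m ∣ l ^ m := pow_dvd_pow_of_dvd (X_dvd_logPoly _) m
  have hq : (X : k[X]) ^ m ∣ (1 + X) * (b - (1 + X)).derivative - (b - (1 + X)) := by
    have e1 : (1 + X) * (b - (1 + X)).derivative - (b - (1 + X)) =
        l ^ m * (-C ((m ! : k)⁻¹) * (1 - (-X) ^ (m + 1))) -
          X ^ m * (b * (-1) ^ (m + 1) * X) := by
      have h1 := one_add_X_mul_derivative_logPoly (k := k) (m + 1)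
      have h2 : (-X : k[X]) ^ (m + 1) = (-1) ^ (m + 1) * (X ^ m * X) := by
        rw [neg_pow, pow_succ X]
      rw [← hl] at h1
      rw [derivative_sub, hd, derivative_add, derivative_one, derivative_X]
      linear_combination (b - C ((m ! : k)⁻¹) * l ^ m) * h1 - b * h2
    rw [e1]
    exact dvd_sub (hXl.mul_right _) (Dvd.intro _ rfl)
  suffices ∀ j ≤ m + 1, X ^ j ∣ b - (1 + X) from this _ le_rfl
  intro j
  induction j with
  | zero => simp
  | succ j ih =>
    intro hj
    apply X_pow_succ_dvd_of_derivative h₀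
    have hcop : IsCoprime (X ^ j : k[X]) (1 + X) :=
      IsCoprime.pow_left ⟨-1, 1, by ring⟩
    refine hcop.dvd_of_dvd_mul_left ?_
    have := dvd_add ((pow_dvd_pow X (show j ≤ m by omega)).trans hq) (ih (by omega))
    simpa using this

end TruncatedExp

/-! ### Exponential and logarithm of nilpotent elements. -/

section NilpotentExp

open TruncatedExp Polynomial

variable (k : Type u) {A : Type v} [Field k] [Ring A] [Algebra k A]

/-- `exp(x)` for `xᵐ = 0`. -/
def truncExp (m : ℕ) (x : A) : A := ∑ n ∈ Finset.range m, ((n ! : k)⁻¹) • x ^ n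

/-- `log(1 + s)` for `sᵐ = 0`. -/
def truncLog (m : ℕ) (s : A) : A :=
  ∑ n ∈ Finset.range m, ((-1 : k) ^ n / ((n : k) + 1)) • s ^ (n + 1)

variable {k}

theorem aeval_expPoly (m : ℕ) (x : A) : aeval x (expPoly k m) = truncExp k m x := by
  simp [expPoly, truncExp, Algebra.smul_def]

theorem aeval_logPoly (m : ℕ) (x : A) : aeval x (logPoly k m) = truncLog k m x := by
  simp [logPoly, truncLog, Algebra.smul_def]

theorem truncExp_eq_of_pow_eq_zero {m n : ℕ} (h : m ≤ n) {x : A} (hx : x ^ m = 0) :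
    truncExp k n x = truncExp k m x := by
  refine (Finset.sum_subset (Finset.range_mono h) fun i _ hi => ?_).symm
  rw [pow_eq_zero_of_le (by simpa using hi) hx, smul_zero]

theorem map_truncExp {B : Type*} [Ring B] [Algebra k B] (f : A →ₐ[k] B) (m : ℕ) (x : A) :
    f (truncExp k m x) = truncExp k m (f x) := by
  simp [truncExp]

theorem truncLog_eq_of_pow_eq_zero {m n : ℕ} (h : m ≤ n) {x : A} (hx : x ^ m = 0) :
    truncLog k n x = truncLog k m x := by
  refine (Finset.sum_subset (Finset.range_mono h) fun i _ hi => ?_).symm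
  rw [pow_eq_zero_of_le (Nat.le_succ_of_le (by simpa using hi)) hx, smul_zero]

theorem map_truncLog {B : Type*} [Ring B] [Algebra k B] (f : A →ₐ[k] B) (m : ℕ) (x : A) :
    f (truncLog k m x) = truncLog k m (f x) := by
  simp [truncLog]

theorem truncExp_zero (m : ℕ) : truncExp k (m + 1) (0 : A) = 1 := by
  simp [truncExp, Finset.sum_range_succ']

theorem truncLog_zero (m : ℕ) : truncLog k m (0 : A) = 0 := by
  simp [truncLog]

variable [CharZero k]

theorem truncLog_truncExp_sub_one {m : ℕ} {x : A} (hx : x ^ (m + 1) = 0) :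
    truncLog k (m + 1) (truncExp k (m + 1) x - 1) = x := by
  obtain ⟨q, hq⟩ := X_pow_dvd_logPoly_comp (k := k) m
  have := congrArg (aeval x) hq
  rw [map_mul, map_pow, aeval_X, hx, zero_mul, map_sub, aeval_X, aeval_comp, map_sub, map_one,
    aeval_expPoly, aeval_logPoly] at this
  exact sub_eq_zero.1 this

theorem truncExp_truncLog {m : ℕ} {s : A} (hs : s ^ (m + 1) = 0) :
    truncExp k (m + 1) (truncLog k (m + 1) s) = 1 + s := by
  obtain ⟨q, hq⟩ := X_pow_dvd_expPoly_comp (k := k) m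
  have := congrArg (aeval s) hq
  rw [map_mul, map_pow, aeval_X, hs, zero_mul, map_sub, map_add, map_one, aeval_X, aeval_comp,
    aeval_expPoly, aeval_logPoly] at this
  exact sub_eq_zero.1 this

theorem truncExp_injOn {m : ℕ} {x y : A} (hx : x ^ m = 0) (hy : y ^ m = 0)
    (h : truncExp k m x = truncExp k m y) : x = y := by
  rcases m with _ | m
  · rw [pow_zero] at hx
    exact (subsingleton_of_zero_eq_one hx.symm).elim x y
  · rw [← truncLog_truncExp_sub_one (k := k) hx, h, truncLog_truncExp_sub_one hy]

theorem truncExp_add {l m n : ℕ} {x y : A} (hx : x ^ l = 0) (hy : y ^ m = 0) (h : Commute x y)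
    (hxy : (x + y) ^ n = 0) :
    truncExp k n (x + y) = truncExp k l x * truncExp k m y := by
  -- `IsNilpotent.exp` needs rational scalars; they act through `k`, and its addition formula is
  -- then available.
  let _ : Algebra ℚ A := Algebra.compHom A (algebraMap ℚ k)
  have e : ∀ (n : ℕ) (x : A), x ^ n = 0 → truncExp k n x = IsNilpotent.exp x := by
    intro n x hx
    rw [IsNilpotent.exp_eq_sum hx, truncExp]
    refine Finset.sum_congr rfl fun i _ => ?_
    change _ = (algebraMap ℚ k _) • x ^ i
    simp
  rw [e _ _ hx, e _ _ hy, e _ _ hxy, IsNilpotent.exp_add_of_commute h ⟨_, hx⟩ ⟨_, hy⟩]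

end NilpotentExp

/-! ### The completion: convergence, primitive and grouplike elements. -/

namespace LieFiltration

open EnvelopingAlgebra UniversalEnvelopingAlgebra Filter Topology

variable {k : Type u} {L : Type v} [Field k] [LieRing L] [LieAlgebra k L]
variable (N : LieFiltration k L)

/-! ### Topology of the completed enveloping algebra -/

variable {N} in
theorem tendsto_completedEnv_iff {α : Type*} {l : Filter α} {f : α → N.CompletedEnv}
    {a : N.CompletedEnv} : Tendsto f l (𝓝 a) ↔ ∀ p, ∀ᶠ i in l, (f i).1 p = a.1 p := by
  rw [nhds_iInf, tendsto_iInf]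
  refine forall_congr' fun p => ?_
  rw [@nhds_induced _ _ ⊥, tendsto_comap_iff]
  have : @nhds (N.EnvQuot p) ⊥ (a.1 p) = pure (a.1 p) :=
    @nhds_discrete _ ⊥ (@DiscreteTopology.mk _ ⊥ rfl) ▸ rfl
  rw [this, tendsto_pure]
  rfl

instance : T2Space N.CompletedEnv := by
  refine t2_iff_nhds.2 fun {x y} h => Subtype.ext (funext fun p => ?_)
  have hx := tendsto_completedEnv_iff.1 (tendsto_id'.2 (inf_le_left : 𝓝 x ⊓ 𝓝 y ≤ 𝓝 x)) p
  have hy := tendsto_completedEnv_iff.1 (tendsto_id'.2 (inf_le_right : 𝓝 x ⊓ 𝓝 y ≤ 𝓝 y)) p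
  obtain ⟨z, hzx, hzy⟩ := (hx.and hy).exists
  exact hzx.symm.trans hzy

variable {N} in
-- Each quotient is discrete, so a series converges once every coordinate of its partial sums
-- becomes stationary.
theorem hasSum_completedEnv {f : ℕ → N.CompletedEnv} {a : N.CompletedEnv}
    (h₀ : ∀ p, ∀ n, p < n → (f n).1 p = 0)
    (h : ∀ p, ∑ n ∈ Finset.range (p + 1), (f n).1 p = a.1 p) : HasSum f a := by
  rw [HasSum, SummationFilter.unconditional_filter]
  refine tendsto_completedEnv_iff.2 fun p => ?_
  filter_upwards [eventually_ge_atTop (Finset.range (p + 1))] with s hs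
  rw [← h p, Finset.sum_subset hs fun n _ hn => h₀ p n (by simpa using hn)]
  have := map_sum ((Pi.evalAlgHom k N.EnvQuot p).comp (inverseLimit N.envTrans).val) f s
  exact this

/-! ### Exponential and logarithm -/

variable {N}

theorem mem_completedAug {x : N.CompletedEnv} : x ∈ N.completedAug ↔ x.1 1 = 0 := by
  obtain ⟨u, hu⟩ := Ideal.Quotient.mk_surjective (x.1 1)
  have h : N.completedCounit x = counit k L u := by
    change Ideal.Quotient.liftₐ (N.envFil 1) (counit k L) (fun _ ha => ha) (x.1 1) = _
    rw [← hu]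
    rfl
  rw [← hu, Ideal.Quotient.eq_zero_iff_mem]
  change N.completedCounit x = 0 ↔ _
  rw [h]
  rfl

theorem mem_oneAddCompletedAug {y : N.CompletedEnv} :
    y ∈ N.oneAddCompletedAug ↔ y - 1 ∈ N.completedAug := by
  constructor
  · rintro ⟨s, hs, rfl⟩
    simpa using hs
  · exact fun h => ⟨y - 1, h, by simp⟩

theorem pow_mem_envFil {u : UniversalEnvelopingAlgebra k L} (hu : u ∈ augIdeal k L) :
    ∀ p : ℕ, u ^ p ∈ N.envFil p
  | 0 => trivial
  | p + 1 => by
    rw [pow_succ]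
    exact N.mul_augIdeal_mem (pow_mem_envFil hu p) hu

theorem coord_pow_eq_zero {x : N.CompletedEnv} (hx : x ∈ N.completedAug) (p : ℕ) :
    (x.1 p) ^ (p + 1) = 0 := by
  obtain ⟨u, hu⟩ := Ideal.Quotient.mk_surjective (x.1 p)
  rcases p with _ | p
  · rw [← hu, ← map_pow]
    exact Ideal.Quotient.eq_zero_iff_mem.2 trivial
  · have h : u ∈ augIdeal k L := by
      have h1 := x.2 (show 1 ≤ p + 1 by omega)
      rw [mem_completedAug.1 hx, ← hu] at h1
      exact Ideal.Quotient.eq_zero_iff_mem.1 h1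
    rw [← hu, ← map_pow]
    exact Ideal.Quotient.eq_zero_iff_mem.2 (N.envFil_succ_le _ (pow_mem_envFil h _))

/-- The limit of the exponential series. -/
def expLim (x : N.CompletedEnv) (hx : x ∈ N.completedAug) : N.CompletedEnv :=
  ⟨fun p => truncExp k (p + 1) (x.1 p), fun p q h => by
    rw [map_truncExp, x.2 h]
    exact truncExp_eq_of_pow_eq_zero (Nat.succ_le_succ h) (coord_pow_eq_zero hx p)⟩

/-- The limit of the logarithm series. -/
def logLim (s : N.CompletedEnv) (hs : s ∈ N.completedAug) : N.CompletedEnv :=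
  ⟨fun p => truncLog k (p + 1) (s.1 p), fun p q h => by
    rw [map_truncLog, s.2 h]
    exact truncLog_eq_of_pow_eq_zero (Nat.succ_le_succ h) (coord_pow_eq_zero hs p)⟩

theorem hasSum_expTerm {x : N.CompletedEnv} (hx : x ∈ N.completedAug) :
    HasSum (N.expTerm x) (expLim x hx) := by
  refine hasSum_completedEnv (fun p n hn => ?_) fun p => rfl
  change (n ! : k)⁻¹ • (x.1 p) ^ n = 0
  rw [pow_eq_zero_of_le hn (coord_pow_eq_zero hx p), smul_zero]

theorem hasSum_logTerm {y : N.CompletedEnv} (hy : y - 1 ∈ N.completedAug) :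
    HasSum (N.logTerm y) (logLim (y - 1) hy) := by
  refine hasSum_completedEnv (fun p n hn => ?_) fun p => rfl
  change ((-1 : k) ^ n / ((n : k) + 1)) • ((y - 1).1 p) ^ (n + 1) = 0
  rw [pow_eq_zero_of_le (Nat.le_succ_of_le hn) (coord_pow_eq_zero hy p), smul_zero]

theorem exp_coord {x : N.CompletedEnv} (hx : x ∈ N.completedAug) (p : ℕ) :
    (N.exp x).1 p = truncExp k (p + 1) (x.1 p) := by
  rw [exp, (hasSum_expTerm hx).tsum_eq]
  rfl

theorem log_coord {y : N.CompletedEnv} (hy : y ∈ N.oneAddCompletedAug) (p : ℕ) :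
    (N.log y).1 p = truncLog k (p + 1) (y.1 p - 1) := by
  rw [log, (hasSum_logTerm (mem_oneAddCompletedAug.1 hy)).tsum_eq]
  rfl

theorem exp_mapsTo : Set.MapsTo N.exp N.completedAug N.oneAddCompletedAug := by
  intro x hx
  rw [mem_oneAddCompletedAug, mem_completedAug]
  change (N.exp x).1 1 - 1 = 0
  rw [exp_coord hx, mem_completedAug.1 hx, truncExp_zero, sub_self]

theorem log_mapsTo : Set.MapsTo N.log N.oneAddCompletedAug N.completedAug := by
  intro y hy
  have h : y.1 1 - 1 = 0 := mem_completedAug.1 (mem_oneAddCompletedAug.1 hy)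
  rw [mem_completedAug, log_coord hy, h, truncLog_zero]

theorem log_exp_invOn [CharZero k] :
    Set.InvOn N.log N.exp N.completedAug N.oneAddCompletedAug := by
  refine ⟨fun x hx => Subtype.ext (funext fun p => ?_), fun y hy => Subtype.ext (funext fun p => ?_)⟩
  · rw [log_coord (exp_mapsTo hx), exp_coord hx,
      truncLog_truncExp_sub_one (coord_pow_eq_zero hx p)]
  · rw [exp_coord (log_mapsTo hy), log_coord hy]
    exact (truncExp_truncLog (coord_pow_eq_zero (mem_oneAddCompletedAug.1 hy) p)).trans
      (add_sub_cancel _ _)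

/-! ### The completed Lie algebra -/

theorem ιLevel_injective [CharZero k] (p : ℕ) : Function.Injective (N.ιLevel p) := by
  rw [← LinearMap.ker_eq_bot, LinearMap.ker_eq_bot']
  intro x hx
  obtain ⟨l, rfl⟩ := Submodule.Quotient.mk_surjective _ x
  exact (Submodule.Quotient.mk_eq_zero _).2
    (N.mem_part_of_ι_mem_envFil (Ideal.Quotient.eq_zero_iff_mem.1 hx))

theorem envTrans_ιLevel {p q : ℕ} (h : p ≤ q) (x : L ⧸ N.lieIdeal q) :
    N.envTrans h (N.ιLevel q x) = N.ιLevel p (N.lieTrans h x) := by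
  obtain ⟨l, rfl⟩ := Submodule.Quotient.mk_surjective _ x
  rfl

theorem completedι_injective [CharZero k] : Function.Injective N.completedι := by
  intro x y h
  refine Subtype.ext (funext fun p => ιLevel_injective p ?_)
  exact congrFun (congrArg Subtype.val h) p

theorem range_completedι_subset : Set.range N.completedι ⊆ N.completedAug := by
  rintro _ ⟨x, rfl⟩
  rw [mem_completedAug]
  change N.ιLevel 1 (x.1 1) = 0
  obtain ⟨l, hl⟩ := Submodule.Quotient.mk_surjective _ (x.1 1)
  rw [← hl]
  exact Ideal.Quotient.eq_zero_iff_mem.2 (ι_mem_augIdeal l)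

/-- Preimages chosen level by level are compatible automatically, because each `ιLevel` is
injective. -/
theorem mem_range_completedι [CharZero k] {x : N.CompletedEnv}
    (h : ∀ p, ∃ y, N.ιLevel p y = x.1 p) : x ∈ Set.range N.completedι := by
  choose y hy using h
  refine ⟨⟨y, fun p q hpq => ιLevel_injective p ?_⟩, Subtype.ext (funext hy)⟩
  rw [← envTrans_ιLevel, hy, hy, x.2 hpq]

/-! ### Grouplike elements -/

theorem exists_coord_eq_mk (x : N.CompletedEnv) {p q : ℕ} (h : p ≤ q) :
    ∃ u : UniversalEnvelopingAlgebra k L,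
      x.1 q = Ideal.Quotient.mk (N.envFil q) u ∧ x.1 p = Ideal.Quotient.mk (N.envFil p) u := by
  obtain ⟨u, hu⟩ := Ideal.Quotient.mk_surjective (x.1 q)
  refine ⟨u, hu.symm, ?_⟩
  rw [← x.2 h, ← hu]
  rfl

theorem mem_grouplike {g : N.CompletedEnv} : g ∈ N.grouplike ↔
    g ≠ 0 ∧ ∀ p, N.comulLevel p (g.1 (2 * p - 1)) = g.1 p ⊗ₜ[k] g.1 p := by
  refine and_congr_right fun _ => ?_
  rw [Subtype.ext_iff, funext_iff]
  rfl

variable (N) in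
/-- The augmentation of `U(L)/Fᵖ` for `1 ≤ p`. -/
def counitLevel {p : ℕ} (h : 1 ≤ p) : N.EnvQuot p →ₐ[k] k :=
  Ideal.Quotient.liftₐ (N.envFil p) (counit k L) fun _ ha => N.envFil_anti h ha

theorem counitLevel_coord (x : N.CompletedEnv) {p : ℕ} (h : 1 ≤ p) :
    N.counitLevel h (x.1 p) = N.completedCounit x := by
  obtain ⟨u, hp, h1⟩ := exists_coord_eq_mk x h
  change _ = Ideal.Quotient.liftₐ (N.envFil 1) (counit k L) (fun _ ha => ha) (x.1 1)
  rw [hp, h1]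
  rfl

/-- The counit axiom at level `p`. -/
theorem counitLevel_comulQuot {p : ℕ} (h : 1 ≤ p) (u : UniversalEnvelopingAlgebra k L) :
    Algebra.TensorProduct.lid k (N.EnvQuot p)
      (Algebra.TensorProduct.map (N.counitLevel h) (AlgHom.id k (N.EnvQuot p))
        (N.comulQuot p p u)) = Ideal.Quotient.mk (N.envFil p) u := by
  have e : ((Algebra.TensorProduct.lid k (N.EnvQuot p)).toAlgHom.comp
      (Algebra.TensorProduct.map (N.counitLevel h) (AlgHom.id k (N.EnvQuot p)))).comp
        (N.comulQuot p p) = Ideal.Quotient.mkₐ k (N.envFil p) := by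
    apply UniversalEnvelopingAlgebra.hom_ext
    refine LieHom.ext fun l => ?_
    have hl : N.counitLevel h (Ideal.Quotient.mkₐ k (N.envFil p) (ι k l)) = 0 := ι_mem_augIdeal l
    change Algebra.TensorProduct.lid k (N.EnvQuot p)
      (Algebra.TensorProduct.map (N.counitLevel h) (AlgHom.id k (N.EnvQuot p))
        (Algebra.TensorProduct.map (Ideal.Quotient.mkₐ k (N.envFil p))
          (Ideal.Quotient.mkₐ k (N.envFil p)) (comul k L (ι k l)))) =
            Ideal.Quotient.mkₐ k (N.envFil p) (ι k l)
    rw [comul_ι, map_add, map_add, map_add, Algebra.TensorProduct.map_tmul,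
      Algebra.TensorProduct.map_tmul, Algebra.TensorProduct.map_tmul,
      Algebra.TensorProduct.map_tmul, hl, map_one, map_one, TensorProduct.zero_tmul, map_zero,
      add_zero, Algebra.TensorProduct.lid_tmul, one_smul, AlgHom.id_apply]
  exact AlgHom.congr_fun e u

/-- Apply `ε ⊗ id` to `Δ(g) = g ⊗ g` and use the counit axiom. -/
theorem completedCounit_smul_coord {g : N.CompletedEnv} (hg : g ∈ N.grouplike) {p : ℕ}
    (h : 1 ≤ p) : N.completedCounit g • g.1 p = g.1 p := by
  obtain ⟨u, hq, hp⟩ := exists_coord_eq_mk g (show p ≤ 2 * p - 1 by omega)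
  have h1 := (mem_grouplike.1 hg).2 p
  rw [hq] at h1
  have h2 := counitLevel_comulQuot (N := N) h u
  change N.comulQuot p p u = _ at h1
  rw [h1, Algebra.TensorProduct.map_tmul, Algebra.TensorProduct.lid_tmul, counitLevel_coord,
    ← hp] at h2
  exact h2

theorem completedCounit_eq_one {g : N.CompletedEnv} (hg : g ∈ N.grouplike) :
    N.completedCounit g = 1 := by
  by_contra hne
  refine hg.1 (Subtype.ext (funext fun p => ?_))
  rcases p with _ | p
  -- At level `0` there is no augmentation, but `F⁰ = U(L)` makes the quotient trivial.
  · obtain ⟨u, hu⟩ := Ideal.Quotient.mk_surjective (g.1 0)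
    rw [← hu]
    exact Ideal.Quotient.eq_zero_iff_mem.2 trivial
  · have h := completedCounit_smul_coord hg (Nat.succ_le_succ (Nat.zero_le p))
    have h' : (N.completedCounit g - 1) • g.1 (p + 1) = 0 := by
      rw [sub_smul, one_smul]
      exact sub_eq_zero.2 h
    exact (smul_eq_zero_iff_right (sub_ne_zero.2 hne)).1 h'

theorem grouplike_subset : N.grouplike ⊆ N.oneAddCompletedAug := by
  intro g hg
  rw [mem_oneAddCompletedAug]
  change N.completedCounit (g - 1) = 0
  rw [map_sub, map_one, completedCounit_eq_one hg, sub_self]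

theorem ne_zero_of_mem_oneAddCompletedAug {y : N.CompletedEnv} (hy : y ∈ N.oneAddCompletedAug) :
    y ≠ 0 := by
  rintro rfl
  have h : N.completedCounit (0 - 1) = 0 := mem_oneAddCompletedAug.1 hy
  simp at h

theorem comulLevel_completedι (y : N.CompletedLie) (p : ℕ) :
    N.comulLevel p ((N.completedι y).1 (2 * p - 1)) =
      1 ⊗ₜ[k] (N.completedι y).1 p + (N.completedι y).1 p ⊗ₜ[k] 1 := by
  have hp := y.2 (show p ≤ 2 * p - 1 by omega)
  obtain ⟨l, hl⟩ := Submodule.Quotient.mk_surjective _ (y.1 (2 * p - 1))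
  change N.comulLevel p (N.ιLevel _ (y.1 (2 * p - 1))) =
    1 ⊗ₜ[k] N.ιLevel p (y.1 p) + N.ιLevel p (y.1 p) ⊗ₜ[k] 1
  rw [← hp, ← hl]
  change Algebra.TensorProduct.map _ _ (comul k L (ι k l)) = _
  rw [comul_ι, map_add, Algebra.TensorProduct.map_tmul, Algebra.TensorProduct.map_tmul]
  rfl

theorem exists_primitive_pow_eq_zero {A : Type*} [Ring A] [Algebra k A] {x : A} {m : ℕ}
    (hx : x ^ m = 0) : ∃ n, (1 ⊗ₜ[k] x + x ⊗ₜ[k] 1 : A ⊗[k] A) ^ n = 0 := by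
  refine Commute.isNilpotent_add (by simp [Commute, SemiconjBy]) ⟨m, ?_⟩ ⟨m, ?_⟩ <;>
    simp [Algebra.TensorProduct.tmul_pow, hx]

/-- Multiplying the two tensor factors of the coproduct at level `p`. -/
theorem mul'_comulLevel_mk (p : ℕ) (u : UniversalEnvelopingAlgebra k L) :
    LinearMap.mul' k (N.EnvQuot p) (N.comulLevel p (Ideal.Quotient.mk _ u)) =
      Ideal.Quotient.mk (N.envFil p) (convSq k L u) := by
  change LinearMap.mul' k (N.EnvQuot p) (Algebra.TensorProduct.map _ _ (comul k L u)) =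
    Ideal.Quotient.mkₐ k (N.envFil p) (LinearMap.mul' k _ (comul k L u))
  generalize comul k L u = t
  induction t with
  | zero => simp only [map_zero]
  | add a b ha hb => simp only [map_add, ha, hb]
  | tmul a b =>
    rw [Algebra.TensorProduct.map_tmul, LinearMap.mul'_apply, LinearMap.mul'_apply, map_mul]

section Primitive

variable [CharZero k]

/-- The exponential of `1 ⊗ x + x ⊗ 1` is the tensor square of the exponential of `x`. -/
theorem truncExp_primitive {A : Type*} [Ring A] [Algebra k A] {x : A} {m n : ℕ}
    (hx : x ^ m = 0) (hn : (1 ⊗ₜ[k] x + x ⊗ₜ[k] 1 : A ⊗[k] A) ^ n = 0) :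
    truncExp k n (1 ⊗ₜ[k] x + x ⊗ₜ[k] 1 : A ⊗[k] A) = truncExp k m x ⊗ₜ[k] truncExp k m x := by
  have h₁ : (1 ⊗ₜ[k] x : A ⊗[k] A) ^ m = 0 := by simp [Algebra.TensorProduct.tmul_pow, hx]
  have h₂ : (x ⊗ₜ[k] 1 : A ⊗[k] A) ^ m = 0 := by simp [Algebra.TensorProduct.tmul_pow, hx]
  have hc : Commute (1 ⊗ₜ[k] x : A ⊗[k] A) (x ⊗ₜ[k] 1) := by
    simp [Commute, SemiconjBy]
  have e₁ : truncExp k m (1 ⊗ₜ[k] x : A ⊗[k] A) = 1 ⊗ₜ[k] truncExp k m x :=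
    (map_truncExp (Algebra.TensorProduct.includeRight : A →ₐ[k] A ⊗[k] A) m x).symm
  have e₂ : truncExp k m (x ⊗ₜ[k] 1 : A ⊗[k] A) = truncExp k m x ⊗ₜ[k] 1 :=
    (map_truncExp (Algebra.TensorProduct.includeLeft : A →ₐ[k] A ⊗[k] A) m x).symm
  rw [truncExp_add h₁ h₂ hc hn, e₁, e₂, Algebra.TensorProduct.tmul_mul_tmul, one_mul, mul_one]

theorem exp_mem_grouplike {x : N.CompletedEnv} (hx : x ∈ Set.range N.completedι) :
    N.exp x ∈ N.grouplike := by
  have hx' := range_completedι_subset hx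
  refine mem_grouplike.2 ⟨ne_zero_of_mem_oneAddCompletedAug (exp_mapsTo hx'), fun p => ?_⟩
  obtain ⟨y, rfl⟩ := hx
  have hpow := congrArg (N.comulLevel p) (coord_pow_eq_zero hx' (2 * p - 1))
  rw [map_pow, map_zero, comulLevel_completedι] at hpow
  rw [exp_coord hx', exp_coord hx', map_truncExp, comulLevel_completedι]
  exact truncExp_primitive (coord_pow_eq_zero hx' p) hpow

/-- Both sides are nilpotent and have exponential `g ⊗ g`: the left because `Δ` is an algebra map
and `g` is grouplike, the right by `truncExp_primitive`. Injectivity of `exp` on nilpotents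
concludes. -/
theorem comulLevel_log {g : N.CompletedEnv} (hg : g ∈ N.grouplike) (p : ℕ) :
    N.comulLevel p ((N.log g).1 (2 * p - 1)) =
      1 ⊗ₜ[k] (N.log g).1 p + (N.log g).1 p ⊗ₜ[k] 1 := by
  have hg' := grouplike_subset hg
  have hx := log_mapsTo hg'
  have hexp : N.exp (N.log g) = g := log_exp_invOn.2 hg'
  have hgp : ∀ q, truncExp k (q + 1) ((N.log g).1 q) = g.1 q := fun q => by
    rw [← exp_coord hx, hexp]
  obtain ⟨n, hn⟩ := exists_primitive_pow_eq_zero (k := k) (coord_pow_eq_zero hx p)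
  have hpow := congrArg (N.comulLevel p) (coord_pow_eq_zero hx (2 * p - 1))
  rw [map_pow, map_zero] at hpow
  -- The two nilpotency bounds are unrelated, so both exponentials are truncated at their maximum.
  refine truncExp_injOn (k := k) (m := max (2 * p - 1 + 1) n)
    (pow_eq_zero_of_le (le_max_left _ _) hpow) (pow_eq_zero_of_le (le_max_right _ _) hn) ?_
  rw [truncExp_eq_of_pow_eq_zero (le_max_left _ _) hpow,
    truncExp_eq_of_pow_eq_zero (le_max_right _ _) hn,
    truncExp_primitive (coord_pow_eq_zero hx p) hn, ← map_truncExp, hgp, hgp]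
  exact (mem_grouplike.1 hg).2 p

/-- Multiplying the tensor factors turns primitivity at level `m` into an eigenvector equation for
`convSq` modulo `F^m`, which allows approximation by an element of `L`. -/
theorem mem_range_completedι_of_primitive {x : N.CompletedEnv}
    (h : ∀ p, N.comulLevel p (x.1 (2 * p - 1)) = 1 ⊗ₜ[k] x.1 p + x.1 p ⊗ₜ[k] 1) :
    x ∈ Set.range N.completedι := by
  refine mem_range_completedι fun p => ?_
  -- The square pays for returning from weights to `F`. Using `p + 1` instead of `p` keeps the
  -- weight positive at `p = 0`, as `exists_sub_ι_mem_allWords` requires.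
  set m := (p + 1) * (p + 1) with hm
  have hpm : p + 1 ≤ m := Nat.le_mul_self _
  obtain ⟨u, huq, hum⟩ := exists_coord_eq_mk x (show m ≤ 2 * m - 1 by omega)
  have hprim : convSq k L u - (2 : k) • u ∈ N.envFil m := by
    have e := congrArg (LinearMap.mul' k (N.EnvQuot m)) (h m)
    rw [huq, mul'_comulLevel_mk, hum, map_add, LinearMap.mul'_apply, LinearMap.mul'_apply,
      one_mul, mul_one, ← map_add] at e
    rw [two_smul]
    exact Ideal.Quotient.eq.1 e
  have hw : convSq k L u - (2 : k) • u ∈ N.toWeight.allWords (p * (p + 2) + 1) := by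
    rw [show p * (p + 2) + 1 = m by rw [hm]; ring]
    exact N.mem_allWords_of_mem_envFil m hprim
  obtain ⟨l, hl⟩ := N.exists_sub_ι_mem_allWords hw
  rw [show p * (p + 2) + 1 = (p + 1) * (p + 1) by ring] at hl
  have hl' := N.envFil_succ_le p (N.mem_envFil_of_mem_allWords hl)
  refine ⟨Submodule.Quotient.mk l, ?_⟩
  rw [← x.2 (show p ≤ m by omega), hum]
  exact (Ideal.Quotient.eq.2 hl').symm

theorem log_mem_range_completedι {g : N.CompletedEnv} (hg : g ∈ N.grouplike) :
    N.log g ∈ Set.range N.completedι :=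
  mem_range_completedι_of_primitive (comulLevel_log hg)

end Primitive

end LieFiltration

end

theorem mainTheorem10 {k : Type u} {L : Type v} [Field k] [CharZero k] [LieRing L]
    [LieAlgebra k L] (N : LieFiltration k L) :
    -- the two series converge where they are used
    (∀ x ∈ N.completedAug, Summable (N.expTerm x)) ∧
    (∀ y ∈ N.oneAddCompletedAug, Summable (N.logTerm y)) ∧
    -- `exp` and `log` are inverse bijections between the augmentation ideal and `1 +` it
    Set.BijOn N.exp N.completedAug N.oneAddCompletedAug ∧
    Set.BijOn N.log N.oneAddCompletedAug N.completedAug ∧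
    Set.InvOn N.log N.exp N.completedAug N.oneAddCompletedAug ∧
    -- the completed Lie algebra sits inside the augmentation ideal, the grouplikes in `1 +` it
    Function.Injective N.completedι ∧
    Set.range N.completedι ⊆ N.completedAug ∧
    N.grouplike ⊆ N.oneAddCompletedAug ∧
    -- the maps restrict to inverse bijections
    Set.BijOn N.exp (Set.range N.completedι) N.grouplike ∧
    Set.BijOn N.log N.grouplike (Set.range N.completedι) ∧
    Set.InvOn N.log N.exp (Set.range N.completedι) N.grouplike := by
  have hinv : Set.InvOn N.log N.exp (Set.range N.completedι) N.grouplike :=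
    LieFiltration.log_exp_invOn.mono LieFiltration.range_completedι_subset
      LieFiltration.grouplike_subset
  have hexp : Set.MapsTo N.exp (Set.range N.completedι) N.grouplike :=
    fun _ hx => LieFiltration.exp_mem_grouplike hx
  have hlog : Set.MapsTo N.log N.grouplike (Set.range N.completedι) :=
    fun _ hg => LieFiltration.log_mem_range_completedι hg
  exact ⟨fun x hx => (LieFiltration.hasSum_expTerm hx).summable,
    fun y hy => (LieFiltration.hasSum_logTerm
      (LieFiltration.mem_oneAddCompletedAug.1 hy)).summable,
    LieFiltration.log_exp_invOn.bijOn LieFiltration.exp_mapsTo LieFiltration.log_mapsTo,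
    LieFiltration.log_exp_invOn.symm.bijOn LieFiltration.log_mapsTo LieFiltration.exp_mapsTo,
    LieFiltration.log_exp_invOn,
    LieFiltration.completedι_injective,
    LieFiltration.range_completedι_subset,
    LieFiltration.grouplike_subset,
    hinv.bijOn hexp hlog,
    hinv.symm.bijOn hlog hexp,
    hinv⟩
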